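/- Let $n\in\{2,3\}$, $q\in\mathbb N_0$, $\sigma,\Lambda\in\mathbb R$. There is a constant $C>0$, depending only on $n,q,\sigma,\Lambda$, such that the following holds. **Meshes.** Let $\Omega\subset\mathbb R^n$ be an open set with $\Omega=\mathrm{int}\,\overline\Omega$ (e.g. a bounded Lipschitz domain), and let $\mathcal T_H$ be a finite conforming triangulation of it into open nondegenerate simplices with ordered vertices, $\overline\Omega=\bigcup_{T\in\mathcal T_H}\overline T$, which is shape regular: each $\overline T$ contains a ball of radius $\rho_T>0$ with $H_T:=\operatorname{diam}T\le\sigma\rho_T$. Let $m\ge 0$ and let $\mathcal S^m(\mathcal T_H)$ be the mesh obtained by subdividing each $T$ uniformly $m$ times (red refinement for $n=2$, Bey's refinement for $n=3$). Let $T_m$ be the set of points of $\overline T$ whose barycentric coordinates are multiples of $2^{-m}$, $\mathring T_m=T_m\cap T$, $\partial T_m=T_m\setminus\mathring T_m$, $\mathbb X_m=\bigcup_T T_m=\{x_i\}$, $\partial\mathbb X_m=\bigcup_T\partial T_m$. Let $\phi_i$ be the continuous, piecewise affine vertex function of $x_i$ on $\mathcal S^m(\mathcal T_H)$. Put $H=\max_T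 H_T$, $h_T=2^{-m}H_T$, $h=2^{-m}H$. **True matrix.** For a tensor $K:\Omega\to\mathbb R^{n\times n}$ with entries in $L^\infty(\Omega)$ let $\mathsf A_{ij}=\int_\Omega\nabla\phi_j^\top K\,\nabla\phi_i\,dx$ for all $x_i,x_j\in\mathbb X_m$. **Stencil functions.** Write $\operatorname{supp}u=\{u\ne0\}$. Let $\mathscr D(\mathring T_m)$ be the set of all $\delta=x_j-x_i$ with $x_i\in\mathring T_m$, $x_j\in\mathbb X_m$ and $\operatorname{supp}\phi_i\cap\operatorname{supp}\phi_j\neq\emptyset$. For each $T$ with $\mathring T_m\ne\emptyset$ fix any $x_k\in\mathring T_m$ and put $\phi(y)=\phi_k(y+x_k)$. For $\delta\in\mathscr D(\mathring T_m)$ put $\phi_\delta(y)=\phi(y-\delta)$, $\Omega_\delta=\operatorname{supp}\phi\cap\operatorname{supp}\phi_\delta$, $T_\delta=\{x\in T: x+y\in T\ \forall y\in\Omega_\delta\}$ and $$\Phi_T^\delta(x)=\int_{\Omega_\delta}\nabla\phi_\delta(y)^\top K(x+y)\nabla\phi(y)\,dy,\qquad x\in\overline{T_\delta}.$$ Let $\Pi_T^\delta:C^0(\overline{T_\delta})\to\mathcal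 P_q(T_\delta)$ be a linear projection onto the (restrictions of) polynomials of total degree at most $q$ with $\|\Pi^\delta_Tf\|_{L^\infty}\le\Lambda\|f\|_{L^\infty}$. **Surrogate matrix.** Define $$\tilde{\mathsf A}_{ij}=\begin{cases}\mathsf A_{ij}&\text{if } x_i,x_j\in\partial\mathbb X_m,\\ (\Pi_T^\delta\Phi_T^\delta)(x_i)&\text{if }\delta=x_j-x_i\in\mathscr D(\mathring T_m)\text{ and } x_i\in\mathring T_m\text{ or }x_j\in\mathring T_m,\ T\in\mathcal T_H,\\0&\text{otherwise.}\end{cases}$$ **Claim.** Let $0\le r\le q$ be an integer, and let $|K|_{W^{r+1,\infty}(T)}$ denote the maximum of $\|\partial^\alpha K_{ab}\|_{L^\infty(T)}$ over $a,b$ and $|\alpha|=r+1$. (a) If $T\in\mathcal T_H$ and $K_{ab}|_T\in W^{r+1,\infty}(T)$ for all $a,b$, then $$\max_{x_i,x_j\in T_m}|\mathsf A_{ij}-\tilde{\mathsf A}_{ij}|\le C\,h_T^{n-2}H_T^{r+1}|K|_{W^{r+1,\infty}(T)}.$$ (b) If $K_{ab}|_T\in W^{r+1,\infty}(T)$ for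 all $a,b$ and all $T\in\mathcal T_H$, then $$\max_{i,j}|\mathsf A_{ij}-\tilde{\mathsf A}_{ij}|\le C\,h^{n-2}H^{r+1}\max_{T\in\mathcal T_H}|K|_{W^{r+1,\infty}(T)}.$$ -/

import Mathlib

open Set MeasureTheory
open scoped ContDiff

noncomputable section

namespace SurrogateFEM

/-- Euclidean space of dimension `n`. -/
abbrev E (n : ℕ) := EuclideanSpace ℝ (Fin n)

/-! ### Sobolev spaces of essentially bounded functions -/

/-- The iterated partial derivative along the coordinate directions `s 0, …, s (k - 1)`.
The index sequences of length `k` enumerate (with repetition) the multi-indices of order `k`. -/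
def partialDeriv {n k : ℕ} (s : Fin k → Fin n) (f : E n → ℝ) (x : E n) : ℝ :=
  iteratedFDeriv ℝ k f x (fun l => EuclideanSpace.single (s l) (1 : ℝ))

/-- `g` is the weak derivative of `v` on the open set `U` along the directions `s`. -/
def IsWeakDeriv {n k : ℕ} (U : Set (E n)) (s : Fin k → Fin n) (v g : E n → ℝ) : Prop :=
  LocallyIntegrableOn v U volume ∧ LocallyIntegrableOn g U volume ∧
    ∀ η : E n → ℝ, ContDiff ℝ ∞ η → HasCompactSupport η → tsupport η ⊆ U →
      ∫ x in U, v x * partialDeriv s η x = (-1 : ℝ) ^ k * ∫ x in U, g x * η x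

/-- Membership in `W^{k,∞}(U)`. -/
def MemSobolev {n : ℕ} (k : ℕ) (U : Set (E n)) (v : E n → ℝ) : Prop :=
  MemLp v ⊤ (volume.restrict U) ∧
    ∀ j ≤ k, ∀ s : Fin j → Fin n, ∃ g, IsWeakDeriv U s v g ∧ MemLp g ⊤ (volume.restrict U)

open Classical in
/-- The weak derivative of `v` along `s` (unique almost everywhere on `U`; zero if there is none). -/
def weakDeriv {n k : ℕ} (U : Set (E n)) (s : Fin k → Fin n) (v : E n → ℝ) : E n → ℝ :=
  if h : ∃ g, IsWeakDeriv U s v g then h.choose else 0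

/-- The seminorm `|v|_{W^{k,∞}(U)}`: the largest `L^∞(U)` norm of a weak derivative of order `k`. -/
def sobolevSeminorm {n : ℕ} (k : ℕ) (U : Set (E n)) (v : E n → ℝ) : ℝ :=
  ⨆ s : Fin k → Fin n, (eLpNorm (weakDeriv U s v) ⊤ (volume.restrict U)).toReal

/-- The seminorm of a matrix field: the maximum over its entries. -/
def tensorSeminorm {n : ℕ} (k : ℕ) (U : Set (E n)) (K : E n → Matrix (Fin n) (Fin n) ℝ) : ℝ :=
  ⨆ a : Fin n, ⨆ b : Fin n, sobolevSeminorm k U (fun x => K x a b)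

/-! ### Macro-meshes and their uniform refinements -/

/-- A macro-element: a nondegenerate simplex with a fixed order of its vertices.
The open simplex is `T.interior`, the closed one is `T.closedInterior`. -/
abbrev Macro (n : ℕ) := Affine.Simplex ℝ (E n) n

/-- `Th` is a conforming simplicial triangulation of `Ω`. The first field holds for every Lipschitz
domain: it says that `Ω` is the interior of its closure. -/
structure IsMacroMesh {n : ℕ} (Ω : Set (E n)) (Th : Set (Macro n)) : Prop where
  regular : interior (closure Ω) = Ω
  finite : Th.Finite
  cover : closure Ω = ⋃ T ∈ Th, T.closedInterior
  disjoint : ∀ T ∈ Th, ∀ T' ∈ Th, T ≠ T' → Disjoint T.interior T'.interior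
  conforming : ∀ T ∈ Th, ∀ T' ∈ Th,
    T.closedInterior ∩ T'.closedInterior = convexHull ℝ (range T.points ∩ range T'.points)

/-- The diameter `H_T`. -/
def elemDiam {n : ℕ} (T : Macro n) : ℝ := Metric.diam T.closedInterior

/-- The mesh size `H = max_T H_T`. -/
def meshSize {n : ℕ} (Th : Set (Macro n)) : ℝ := ⨆ T : Th, elemDiam T.1

/-- Shape regularity with parameter `σ`: every element contains a ball whose radius `ρ` satisfies
`H_T ≤ σ ρ`. -/
def ShapeRegular {n : ℕ} (σ : ℝ) (Th : Set (Macro n)) : Prop :=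
  ∀ T ∈ Th, ∃ (z : E n) (ρ : ℝ), 0 < ρ ∧ Metric.closedBall z ρ ⊆ T.closedInterior ∧
    elemDiam T ≤ σ * ρ

/-- The subdivision of a triangle or tetrahedron into `2 ^ n` simplices of equal volume through
the midpoints of its edges: red refinement for `n = 2`, Bey's refinement for `n = 3`.
(Other dimensions are not used.) -/
def subdivide : {n : ℕ} → (Fin (n + 1) → E n) → Set (Fin (n + 1) → E n)
  | 2, y =>
    let m := fun i j => midpoint ℝ (y i) (y j)
    {![y 0, m 0 1, m 0 2], ![m 0 1, y 1, m 1 2], ![m 0 2, m 1 2, y 2], ![m 0 1, m 1 2, m 0 2]}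
  | 3, y =>
    let m := fun i j => midpoint ℝ (y i) (y j)
    {![y 0, m 0 1, m 0 2, m 0 3], ![m 0 1, y 1, m 1 2, m 1 3],
      ![m 0 2, m 1 2, y 2, m 2 3], ![m 0 3, m 1 3, m 2 3, y 3],
      ![m 0 1, m 0 2, m 0 3, m 1 3], ![m 0 1, m 0 2, m 1 2, m 1 3],
      ![m 0 2, m 0 3, m 1 3, m 2 3], ![m 0 2, m 1 2, m 1 3, m 2 3]}
  | _, y => {y}

/-- The `m`-fold subdivision of a simplex. -/
def refine {n : ℕ} : ℕ → (Fin (n + 1) → E n) → Set (Fin (n + 1) → E n)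
  | 0, y => {y}
  | m + 1, y => ⋃ t ∈ refine m y, subdivide t

/-- The locally-structured mesh of level `m`. -/
def fineMesh {n : ℕ} (Th : Set (Macro n)) (m : ℕ) : Set (Fin (n + 1) → E n) :=
  ⋃ T ∈ Th, refine m T.points

/-- The simplicial lattice `T_m`: the affine image of the points of `2^{-m} ℤ^n` in the closed
reference simplex, i.e. the points of `T` whose barycentric coordinates are multiples
of `2^{-m}`. -/
def lattice {n : ℕ} (m : ℕ) (T : Macro n) : Set (E n) :=
  {x | ∃ k : Fin (n + 1) → ℕ, ∑ i, k i = 2 ^ m ∧ x = ∑ i, ((k i : ℝ) / 2 ^ m) • T.points i}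

/-- The lattice points in the open simplex. -/
def latticeInterior {n : ℕ} (m : ℕ) (T : Macro n) : Set (E n) := lattice m T ∩ T.interior

/-- The lattice points on the boundary of the simplex. -/
def latticeBoundary {n : ℕ} (m : ℕ) (T : Macro n) : Set (E n) :=
  lattice m T \ latticeInterior m T

/-- All vertices of level `m`. -/
def vertices {n : ℕ} (Th : Set (Macro n)) (m : ℕ) : Set (E n) := ⋃ T ∈ Th, lattice m T

/-- All macro-mesh boundary vertices of level `m`. -/
def boundaryVertices {n : ℕ} (Th : Set (Macro n)) (m : ℕ) : Set (E n) :=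
  ⋃ T ∈ Th, latticeBoundary m T

/-- The vertex function of `z` on a conforming simplicial mesh `S`: at a point `x` with barycentric
coordinates `w` in a simplex `t` of `S` its value is the sum of the `w k` with `t k = z`, that is,
the value at `x` of the affine interpolant on `t` of the nodal values `1` at `z` and `0` elsewhere.
(By conformity this does not depend on `t`; the function is extended by zero outside the mesh.) -/
def vertexFn {n : ℕ} (S : Set (Fin (n + 1) → E n)) (z x : E n) : ℝ :=
  sSup {c | ∃ t ∈ S, ∃ w ∈ stdSimplex ℝ (Fin (n + 1)), ∑ k, w k • t k = x ∧
    c = ∑ k, w k * indicator {z} (fun _ => (1 : ℝ)) (t k)}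

/-! ### The true stiffness matrix -/

/-- The integrand `∇u^⊤ K ∇v` of the bilinear form, with a given value `M` of `K`. -/
def flux {n : ℕ} (M : Matrix (Fin n) (Fin n) ℝ) (p r : E n) : ℝ :=
  ∑ a, ∑ b, p a * M a b * r b

/-- The bilinear form `a(u, v) = ∫_Ω ∇u^⊤ K ∇v`, for piecewise smooth Lipschitz functions. -/
def bilinForm {n : ℕ} (Ω : Set (E n)) (K : E n → Matrix (Fin n) (Fin n) ℝ) (u v : E n → ℝ) : ℝ :=
  ∫ x in Ω, flux (K x) (gradient u x) (gradient v x)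

/-- The true stiffness matrix, `A_{ij} = a(φ_j, φ_i)`. -/
def trueMatrix {n : ℕ} (Ω : Set (E n)) (Th : Set (Macro n)) (m : ℕ)
    (K : E n → Matrix (Fin n) (Fin n) ℝ) : Matrix (vertices Th m) (vertices Th m) ℝ :=
  fun i j => bilinForm Ω K (vertexFn (fineMesh Th m) j) (vertexFn (fineMesh Th m) i)

/-! ### Stencil functions -/

/-- The set `𝒟(T̊_m)` of translations from an interior lattice point of `T` to a vertex such that the
two vertex functions have overlapping supports. -/
def translations {n : ℕ} (Th : Set (Macro n)) (m : ℕ) (T : Macro n) : Set (E n) :=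
  {δ | ∃ x ∈ latticeInterior m T, ∃ x' ∈ vertices Th m, δ = x' - x ∧
    (Function.support (vertexFn (fineMesh Th m) x) ∩
      Function.support (vertexFn (fineMesh Th m) x')).Nonempty}

/-- The test function `φ(y) = φ_c(y + c)` centred at the origin. -/
def testFn {n : ℕ} (Th : Set (Macro n)) (m : ℕ) (c : E n) (y : E n) : ℝ :=
  vertexFn (fineMesh Th m) c (y + c)

/-- The translated function `φ_δ(y) = φ(y - δ)`. -/
def shift {n : ℕ} (φ : E n → ℝ) (δ y : E n) : ℝ := φ (y - δ)

/-- `Ω_δ = supp φ ∩ supp φ_δ`, where `supp` is the set of points at which a function is nonzero. -/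
def overlap {n : ℕ} (φ : E n → ℝ) (δ : E n) : Set (E n) :=
  Function.support φ ∩ Function.support (shift φ δ)

/-- The stencil function `Φ^δ(x) = ∫_{Ω_δ} ∇φ_δ(y)^⊤ K(x + y) ∇φ(y) dy`. -/
def stencilFn {n : ℕ} (K : E n → Matrix (Fin n) (Fin n) ℝ) (φ : E n → ℝ) (δ x : E n) : ℝ :=
  ∫ y in overlap φ δ, flux (K (x + y)) (gradient (shift φ δ) y) (gradient φ y)

/-- The closure of `T_δ = {x ∈ T : x + y ∈ T for all y ∈ Ω_δ}`. -/
def stencilDomain {n : ℕ} (T : Macro n) (φ : E n → ℝ) (δ : E n) : Set (E n) :=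
  closure {x | x ∈ T.interior ∧ ∀ y ∈ overlap φ δ, x + y ∈ T.interior}

/-- `f` is the restriction to `S` of a polynomial of total degree at most `q`. -/
def IsPolyOn {n : ℕ} (q : ℕ) {S : Set (E n)} (f : C(S, ℝ)) : Prop :=
  ∃ p : MvPolynomial (Fin n) ℝ, p.totalDegree ≤ q ∧
    ∀ x : S, f x = MvPolynomial.eval (fun a => x.1 a) p

/-- `P` is a linear projection of `C⁰(S)` onto the polynomials of degree at most `q`, continuous in
the maximum norm with constant `Λ`. -/
structure IsPolyProjection {n : ℕ} (q : ℕ) (Λ : ℝ) {S : Set (E n)}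
    (P : C(S, ℝ) →ₗ[ℝ] C(S, ℝ)) : Prop where
  mem : ∀ f, IsPolyOn q (P f)
  fix : ∀ f, IsPolyOn q f → P f = f
  bound : ∀ (f : C(S, ℝ)) (M : ℝ), (∀ x, |f x| ≤ M) → ∀ x, |P f x| ≤ Λ * M

open Classical in
/-- The projected function `P f` for a function `f` that is continuous on `S`, as a function
on `S` extended by zero. -/
def project {n : ℕ} {S : Set (E n)} (P : C(S, ℝ) →ₗ[ℝ] C(S, ℝ)) (f : E n → ℝ) (x : E n) : ℝ :=
  if hf : ContinuousOn f S then
    if hx : x ∈ S then P ⟨S.domRestrict f, hf.domRestrict⟩ ⟨x, hx⟩ else 0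
  else 0

/-- A choice of operators `Π^δ_T` on `C⁰` of the closure of `T_δ`, where the stencil of `T` is taken
from the interior lattice point `c T`. -/
abbrev ProjectionFamily {n : ℕ} (Th : Set (Macro n)) (m : ℕ) (c : Macro n → E n) :=
  ∀ (T : Macro n) (δ : E n),
    C(stencilDomain T (testFn Th m (c T)) δ, ℝ) →ₗ[ℝ] C(stencilDomain T (testFn Th m (c T)) δ, ℝ)

/-- The surrogate stencil function `Π^δ_T Φ^δ_T`. -/
def surrogateStencilFn {n : ℕ} (Th : Set (Macro n)) (m : ℕ)
    (K : E n → Matrix (Fin n) (Fin n) ℝ) (c : Macro n → E n) (P : ProjectionFamily Th m c)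
    (T : Macro n) (δ x : E n) : ℝ :=
  project (P T δ) (stencilFn K (testFn Th m (c T)) δ) x

/-! ### The surrogate stiffness matrix -/

open Classical in
/-- The surrogate stiffness matrix: exact entries for pairs of macro-mesh boundary vertices,
surrogate stencil values `(Π^δ_T Φ^δ_T)(x_i)` if `δ = x_j - x_i ∈ 𝒟(T̊_m)` and `x_i` or `x_j` lies in
`T̊_m` (there is at most one such `T`), and zero otherwise. -/
def surrogateMatrix {n : ℕ} (Ω : Set (E n)) (Th : Set (Macro n)) (m : ℕ)
    (K : E n → Matrix (Fin n) (Fin n) ℝ) (c : Macro n → E n) (P : ProjectionFamily Th m c) :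
    Matrix (vertices Th m) (vertices Th m) ℝ :=
  fun i j =>
    if i.1 ∈ boundaryVertices Th m ∧ j.1 ∈ boundaryVertices Th m then
      trueMatrix Ω Th m K i j
    else if h : ∃ T ∈ Th, j.1 - i.1 ∈ translations Th m T ∧
        (i.1 ∈ latticeInterior m T ∨ j.1 ∈ latticeInterior m T) then
      surrogateStencilFn Th m K c P h.choose (j.1 - i.1) i.1
    else 0

/-- The maximum of `|M_{ij}|` over the (finitely many) vertices `i`, `j` in the set `S`. -/
def maxNormOn {n : ℕ} {V : Set (E n)} (S : Set (E n)) (M : Matrix V V ℝ) : ℝ :=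
  sSup {c | ∃ i j : V, i.1 ∈ S ∧ j.1 ∈ S ∧ c = |M i j|}

/-- The norm `‖M‖_max`. -/
def maxNorm {n : ℕ} {V : Set (E n)} (M : Matrix V V ℝ) : ℝ := maxNormOn V M

end SurrogateFEM

end

noncomputable section

namespace SurrogateFEM

variable {n : ℕ}

/-! ### Uniform refinement: covering and integrality -/

/-! The proof has a combinatorial half and an analytic half.

Combinatorial half. In an element T let `tail` be the partial sums of the linear parts of the
barycentric coordinates, and `wall` the differences of two such sums. On the vertices of any simplex
of the m-fold refinement, 2^m times a wall takes at most two consecutive integer values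
(`wall_mem_refine`), so no integer level set of it cuts through the simplex. The largest wall `osc`
is therefore governed by a single functional on each refined simplex where this matters, and `hat` =
max(0, 1 - 2^m `osc`) is affine there and equal to the Kronecker delta on lattice displacements
(`hat_affine`, `hat_sub_of_mem_lattice`). Hence inside T every vertex function of a lattice point z
of T is the translate `hat m T (x - z)`, and this holds everywhere if z is interior. So a matrix
entry with an index interior to T is either zero or a value of the stencil function, taken at a
point of the closure of T_δ; each entry of the error matrix is zero or a projection error f(x_i) -
(Πf)(x_i) of a stencil function f (`trueMatrix_sub_surrogateMatrix`).

Analytic half. The stencil function is a sum of correlations of the entries of K with fixed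
integrable weights (`stencilFn_eq_corr`). Correlation maps polynomials of degree at most r to
polynomials of degree at most r (`isPolyFun_corr_prod`), which Π reproduces because r ≤ q. If p is a
polynomial approximation of K on T and Q its stencil function, then f - Πf = (f - Q) - Π(f - Q), so
the error is at most (1 + |Λ|) sup |f - Q|, and sup |f - Q| is controlled by the L^∞ norm of K - p
times the L¹ norm of the weights. The first factor is of order H_T^(r+1) |K| by Taylor expansion of
mollified entries (`MemSobolev.exists_polynomial_approx`). The second is of order h_T^n · h_T^(-2):
the volume of the support times two gradients (`integral_abs_weight_le`). -/

/-- Integer vertex values that take at most two consecutive values and do not alternate. -/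
def Consecutive (z : Fin (n + 1) → ℤ) : Prop :=
  (∃ a, ∀ k, z k = a ∨ z k = a + 1) ∧
    ∀ i j k l, i < j → j < k → k < l → z i = z k → z j = z l → z i = z j

lemma map_midpoint_real (f : E n →ᵃ[ℝ] ℝ) (x y : E n) :
    f (midpoint ℝ x y) = (f x + f y) / 2 := by
  rw [AffineMap.map_midpoint, midpoint_eq_smul_add]
  simp; ring

/-- At the midpoint of y_i and y_j the functional with doubled factor has the value z_i + z_j. In a
corner child all sums share one summand; in the middle child the sums 2a and 2a + 2 cannot both
occur, since that would need four values. -/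
lemma subdivide_consecutive_two {y t : Fin 3 → E 2} (ht : t ∈ subdivide y) (f : E 2 →ᵃ[ℝ] ℝ)
    (c : ℝ) {z : Fin 3 → ℤ} (hz : ∀ k, c * f (y k) = z k) (hc : Consecutive z) :
    ∃ z' : Fin 3 → ℤ, (∀ k, c * 2 * f (t k) = z' k) ∧ Consecutive z' := by
  obtain ⟨⟨a, ha⟩, -⟩ := hc
  have h0 := hz 0
  have h1 := hz 1
  have h2 := hz 2
  have a0 := ha 0
  have a1 := ha 1
  have a2 := ha 2
  have key : ∀ z' : Fin 3 → ℤ, (∃ a, (z' 0 = a ∨ z' 0 = a + 1) ∧ (z' 1 = a ∨ z' 1 = a + 1) ∧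
      (z' 2 = a ∨ z' 2 = a + 1)) → Consecutive z' := by
    rintro z' ⟨a, h0, h1, h2⟩
    refine ⟨⟨a, ?_⟩, ?_⟩
    · intro k; fin_cases k <;> assumption
    -- Three indices contain no increasing chain of four, so alternation is impossible.
    · intro i j k l; omega
  simp only [subdivide, mem_insert_iff, mem_singleton_iff] at ht
  rcases ht with rfl | rfl | rfl | rfl
  · refine ⟨![z 0 + z 0, z 0 + z 1, z 0 + z 2], ?_, key _ ?_⟩
    · intro k; fin_cases k <;> simp [-AffineMap.map_midpoint, map_midpoint_real] <;> linarith
    · simp only [Matrix.cons_val]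
      rcases a0 with a0 | a0
      · exact ⟨2 * a, by omega⟩
      · exact ⟨2 * a + 1, by omega⟩
  · refine ⟨![z 0 + z 1, z 1 + z 1, z 1 + z 2], ?_, key _ ?_⟩
    · intro k; fin_cases k <;> simp [-AffineMap.map_midpoint, map_midpoint_real] <;> linarith
    · simp only [Matrix.cons_val]
      rcases a1 with a0 | a0
      · exact ⟨2 * a, by omega⟩
      · exact ⟨2 * a + 1, by omega⟩
  · refine ⟨![z 0 + z 2, z 1 + z 2, z 2 + z 2], ?_, key _ ?_⟩
    · intro k; fin_cases k <;> simp [-AffineMap.map_midpoint, map_midpoint_real] <;> linarith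
    · simp only [Matrix.cons_val]
      rcases a2 with a0 | a0
      · exact ⟨2 * a, by omega⟩
      · exact ⟨2 * a + 1, by omega⟩
  · refine ⟨![z 0 + z 1, z 1 + z 2, z 0 + z 2], ?_, key _ ?_⟩
    · intro k; fin_cases k <;> simp [-AffineMap.map_midpoint, map_midpoint_real] <;> linarith
    · simp only [Matrix.cons_val]
      -- At most one of the values is a + 1, so no pair sums to 2a + 2.
      by_cases h : z 0 + z 1 + z 2 ≤ 3 * a + 1
      · exact ⟨2 * a, by omega⟩
      · exact ⟨2 * a + 1, by omega⟩

/-- The four inner tetrahedra share the edge from the midpoint of y_0 y_2 to that of y_1 y_3. Its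
end values z_0 + z_2 and z_1 + z_3 differ by two exactly when z alternates, which is why
`Consecutive` forbids alternation; Bey's vertex order passes this property on to the children. -/
lemma subdivide_consecutive_three {y t : Fin 4 → E 3} (ht : t ∈ subdivide y) (f : E 3 →ᵃ[ℝ] ℝ)
    (c : ℝ) {z : Fin 4 → ℤ} (hz : ∀ k, c * f (y k) = z k) (hc : Consecutive z) :
    ∃ z' : Fin 4 → ℤ, (∀ k, c * 2 * f (t k) = z' k) ∧ Consecutive z' := by
  obtain ⟨⟨a, ha⟩, hb⟩ := hc
  have h0 := hz 0
  have h1 := hz 1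
  have h2 := hz 2
  have h3 := hz 3
  have a0 := ha 0
  have a1 := ha 1
  have a2 := ha 2
  have a3 := ha 3
  replace hb := hb 0 1 2 3 (by decide) (by decide) (by decide)
  -- Pairwise differences of at most one replace the existential window, so `omega` need not guess
  -- its lower end.
  have key : ∀ z0 z1 z2 z3 : ℤ, ((z0 = z1 ∨ z0 = z1 + 1 ∨ z1 = z0 + 1) ∧
      (z0 = z2 ∨ z0 = z2 + 1 ∨ z2 = z0 + 1) ∧ (z0 = z3 ∨ z0 = z3 + 1 ∨ z3 = z0 + 1) ∧
      (z1 = z2 ∨ z1 = z2 + 1 ∨ z2 = z1 + 1) ∧ (z1 = z3 ∨ z1 = z3 + 1 ∨ z3 = z1 + 1) ∧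
      (z2 = z3 ∨ z2 = z3 + 1 ∨ z3 = z2 + 1)) ∧
      (z0 = z2 → z1 = z3 → z0 = z1) →
      Consecutive ![z0, z1, z2, z3] := by
    rintro z0 z1 z2 z3 ⟨h, h'⟩
    refine ⟨⟨min (min z0 z1) (min z2 z3), ?_⟩, ?_⟩
    · intro k; fin_cases k <;>
        simp only [Fin.zero_eta, Fin.mk_one, Fin.reduceFinMk, Matrix.cons_val] <;> omega
    · intro i j k l h1 h2 h3
      have hl := l.2
      rw [Fin.lt_def] at h1 h2 h3
      obtain rfl : i = 0 := Fin.ext (show i.val = 0 by omega)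
      obtain rfl : j = 1 := Fin.ext (show j.val = 1 by omega)
      obtain rfl : k = 2 := Fin.ext (show k.val = 2 by omega)
      obtain rfl : l = 3 := Fin.ext (show l.val = 3 by omega)
      simpa using h'
  have fin : ∀ (z0 z1 z2 z3 : ℤ), c * 2 * f (t 0) = z0 → c * 2 * f (t 1) = z1 →
      c * 2 * f (t 2) = z2 → c * 2 * f (t 3) = z3 → Consecutive ![z0, z1, z2, z3] →
      ∃ z' : Fin 4 → ℤ, (∀ k, c * 2 * f (t k) = z' k) ∧ Consecutive z' := by
    intro z0 z1 z2 z3 h0 h1 h2 h3 h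
    refine ⟨_, ?_, h⟩
    intro k; fin_cases k <;> simpa
  simp only [subdivide, mem_insert_iff, mem_singleton_iff] at ht
  rcases ht with rfl | rfl | rfl | rfl | rfl | rfl | rfl | rfl
  · refine fin (z 0 + z 0) (z 0 + z 1) (z 0 + z 2) (z 0 + z 3) ?_ ?_ ?_ ?_
        (key _ _ _ _ (by omega)) <;>
      simp [-AffineMap.map_midpoint, map_midpoint_real] <;> linarith
  · refine fin (z 0 + z 1) (z 1 + z 1) (z 1 + z 2) (z 1 + z 3) ?_ ?_ ?_ ?_
        (key _ _ _ _ (by omega)) <;>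
      simp [-AffineMap.map_midpoint, map_midpoint_real] <;> linarith
  · refine fin (z 0 + z 2) (z 1 + z 2) (z 2 + z 2) (z 2 + z 3) ?_ ?_ ?_ ?_
        (key _ _ _ _ (by omega)) <;>
      simp [-AffineMap.map_midpoint, map_midpoint_real] <;> linarith
  · refine fin (z 0 + z 3) (z 1 + z 3) (z 2 + z 3) (z 3 + z 3) ?_ ?_ ?_ ?_
        (key _ _ _ _ (by omega)) <;>
      simp [-AffineMap.map_midpoint, map_midpoint_real] <;> linarith
  · refine fin (z 0 + z 1) (z 0 + z 2) (z 0 + z 3) (z 1 + z 3) ?_ ?_ ?_ ?_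
        (key _ _ _ _ (by omega)) <;>
      simp [-AffineMap.map_midpoint, map_midpoint_real] <;> linarith
  · refine fin (z 0 + z 1) (z 0 + z 2) (z 1 + z 2) (z 1 + z 3) ?_ ?_ ?_ ?_
        (key _ _ _ _ (by omega)) <;>
      simp [-AffineMap.map_midpoint, map_midpoint_real] <;> linarith
  · refine fin (z 0 + z 2) (z 0 + z 3) (z 1 + z 3) (z 2 + z 3) ?_ ?_ ?_ ?_
        (key _ _ _ _ (by omega)) <;>
      simp [-AffineMap.map_midpoint, map_midpoint_real] <;> linarith
  · refine fin (z 0 + z 2) (z 1 + z 2) (z 1 + z 3) (z 2 + z 3) ?_ ?_ ?_ ?_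
        (key _ _ _ _ (by omega)) <;>
      simp [-AffineMap.map_midpoint, map_midpoint_real] <;> linarith

/-- Used for two kinds of functionals: barycentric coordinates, to place the refined vertices in the
lattice, and walls, to show that `hat` is affine on refined simplices. -/
lemma refine_consecutive (hn : n = 2 ∨ n = 3) (f : E n →ᵃ[ℝ] ℝ) {y : Fin (n + 1) → E n}
    {z : Fin (n + 1) → ℤ} (hz : ∀ k, f (y k) = z k) (hc : Consecutive z) (m : ℕ) :
    ∀ t ∈ refine m y, ∃ z' : Fin (n + 1) → ℤ, (∀ k, 2 ^ m * f (t k) = z' k) ∧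
      Consecutive z' := by
  induction m with
  | zero => rintro t rfl; exact ⟨z, by simpa using hz, hc⟩
  | succ m ih =>
    intro t ht
    obtain ⟨s, hs, hts⟩ := mem_iUnion₂.1 ht
    obtain ⟨z', h1, h2⟩ := ih s hs
    rw [pow_succ]
    rcases hn with rfl | rfl
    · exact subdivide_consecutive_two hts f _ h1 h2
    · exact subdivide_consecutive_three hts f _ h1 h2

lemma subdivide_vertex_mem {s : Set (E n)} (hs : Convex ℝ s) {y t : Fin (n + 1) → E n}
    (ht : t ∈ subdivide y) (hy : ∀ k, y k ∈ s) (k) : t k ∈ s := by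
  have hm : ∀ i j, midpoint ℝ (y i) (y j) ∈ s := fun i j => hs.midpoint_mem (hy i) (hy j)
  unfold subdivide at ht
  split at ht
  · simp only [mem_insert_iff, mem_singleton_iff] at ht
    rcases ht with rfl | rfl | rfl | rfl <;> fin_cases k <;> first | exact hm _ _ | exact hy _
  · simp only [mem_insert_iff, mem_singleton_iff] at ht
    rcases ht with rfl | rfl | rfl | rfl | rfl | rfl | rfl | rfl <;> fin_cases k <;>
      first | exact hm _ _ | exact hy _
  · obtain rfl := ht; exact hy k

lemma refine_vertex_mem {s : Set (E n)} (hs : Convex ℝ s) {y : Fin (n + 1) → E n}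
    (hy : ∀ k, y k ∈ s) (m : ℕ) : ∀ t ∈ refine m y, ∀ k, t k ∈ s := by
  induction m with
  | zero => rintro t rfl; exact hy
  | succ m ih =>
    intro t ht
    obtain ⟨u, hu, hts⟩ := mem_iUnion₂.1 ht
    exact subdivide_vertex_mem hs hts (ih u hu)

lemma mem_stdSimplex_three {a b c : ℝ} (ha : 0 ≤ a) (hb : 0 ≤ b) (hc : 0 ≤ c)
    (h : a + b + c = 1) : ![a, b, c] ∈ stdSimplex ℝ (Fin 3) := by
  refine ⟨fun k => ?_, by simpa [Fin.sum_univ_three] using h⟩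
  fin_cases k <;> simpa

lemma mem_stdSimplex_four {a b c d : ℝ} (ha : 0 ≤ a) (hb : 0 ≤ b) (hc : 0 ≤ c) (hd : 0 ≤ d)
    (h : a + b + c + d = 1) : ![a, b, c, d] ∈ stdSimplex ℝ (Fin 4) := by
  refine ⟨fun k => ?_, by simpa [Fin.sum_univ_four] using h⟩
  fin_cases k <;> simpa

/-- A point with a coordinate at least 1/2 lies in that corner; otherwise the numbers 1 - 2 w_k are
its coordinates in the middle triangle. -/
lemma subdivide_cover_two (y : Fin 3 → E 2) {w : Fin 3 → ℝ} (hw : w ∈ stdSimplex ℝ (Fin 3)) :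
    ∃ t ∈ subdivide y, ∃ w' ∈ stdSimplex ℝ (Fin 3), ∑ k, w' k • t k = ∑ k, w k • y k := by
  have h0 := hw.1 0
  have h1 := hw.1 1
  have h2 := hw.1 2
  have hs := hw.2
  rw [Fin.sum_univ_three] at hs
  have e0 : w 0 = 1 - w 1 - w 2 := by linarith
  simp only [subdivide]
  by_cases c0 : 1 / 2 ≤ w 0
  · refine ⟨_, Or.inl rfl, _, mem_stdSimplex_three (a := 2 * w 0 - 1) (b := 2 * w 1)
      (c := 2 * w 2) (by linarith) (by linarith) (by linarith) (by linarith), ?_⟩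
    simp [Fin.sum_univ_three, midpoint_eq_smul_add, e0]
    match_scalars <;> ring
  by_cases c1 : 1 / 2 ≤ w 1
  · refine ⟨_, Or.inr (Or.inl rfl), _, mem_stdSimplex_three (a := 2 * w 0) (b := 2 * w 1 - 1)
      (c := 2 * w 2) (by linarith) (by linarith) (by linarith) (by linarith), ?_⟩
    simp [Fin.sum_univ_three, midpoint_eq_smul_add, e0]
    match_scalars <;> ring
  by_cases c2 : 1 / 2 ≤ w 2
  · refine ⟨_, Or.inr (Or.inr (Or.inl rfl)), _, mem_stdSimplex_three (a := 2 * w 0)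
      (b := 2 * w 1) (c := 2 * w 2 - 1) (by linarith) (by linarith) (by linarith)
      (by linarith), ?_⟩
    simp [Fin.sum_univ_three, midpoint_eq_smul_add, e0]
    match_scalars <;> ring
  · refine ⟨_, Or.inr (Or.inr (Or.inr rfl)), _, mem_stdSimplex_three (a := 1 - 2 * w 2)
      (b := 1 - 2 * w 0) (c := 1 - 2 * w 1) (by linarith) (by linarith) (by linarith)
      (by linarith), ?_⟩
    simp [Fin.sum_univ_three, midpoint_eq_smul_add, e0]
    match_scalars <;> ring

lemma subdivide_cover_three (y : Fin 4 → E 3) {w : Fin 4 → ℝ} (hw : w ∈ stdSimplex ℝ (Fin 4)) :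
    ∃ t ∈ subdivide y, ∃ w' ∈ stdSimplex ℝ (Fin 4), ∑ k, w' k • t k = ∑ k, w k • y k := by
  have h0 := hw.1 0
  have h1 := hw.1 1
  have h2 := hw.1 2
  have h3 := hw.1 3
  have hs := hw.2
  rw [Fin.sum_univ_four] at hs
  have e0 : w 0 = 1 - w 1 - w 2 - w 3 := by linarith
  have key : ∀ (t : Fin 4 → E 3), t ∈ subdivide y → ∀ a b c d : ℝ, 0 ≤ a → 0 ≤ b → 0 ≤ c →
      0 ≤ d → a + b + c + d = 1 →
      a • t 0 + b • t 1 + c • t 2 + d • t 3 = w 0 • y 0 + w 1 • y 1 + w 2 • y 2 + w 3 • y 3 →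
      ∃ t ∈ subdivide y, ∃ w' ∈ stdSimplex ℝ (Fin 4), ∑ k, w' k • t k = ∑ k, w k • y k := by
    intro t ht a b c d ha hb hc hd h e
    exact ⟨t, ht, _, mem_stdSimplex_four ha hb hc hd h, by simpa [Fin.sum_univ_four] using e⟩
  by_cases c0 : 1 / 2 ≤ w 0
  · refine key _ (Or.inl rfl) (2 * w 0 - 1) (2 * w 1) (2 * w 2) (2 * w 3) (by linarith)
      (by linarith) (by linarith) (by linarith) (by linarith) ?_
    simp [midpoint_eq_smul_add, e0]
    match_scalars <;> ring
  by_cases c1 : 1 / 2 ≤ w 1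
  · refine key _ (Or.inr (Or.inl rfl)) (2 * w 0) (2 * w 1 - 1) (2 * w 2) (2 * w 3) (by linarith)
      (by linarith) (by linarith) (by linarith) (by linarith) ?_
    simp [midpoint_eq_smul_add, e0]
    match_scalars <;> ring
  by_cases c2 : 1 / 2 ≤ w 2
  · refine key _ (Or.inr (Or.inr (Or.inl rfl))) (2 * w 0) (2 * w 1) (2 * w 2 - 1) (2 * w 3)
      (by linarith) (by linarith) (by linarith) (by linarith) (by linarith) ?_
    simp [midpoint_eq_smul_add, e0]
    match_scalars <;> ring
  by_cases c3 : 1 / 2 ≤ w 3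
  · refine key _ (Or.inr (Or.inr (Or.inr (Or.inl rfl)))) (2 * w 0) (2 * w 1) (2 * w 2)
      (2 * w 3 - 1) (by linarith) (by linarith) (by linarith) (by linarith) (by linarith) ?_
    simp [midpoint_eq_smul_add, e0]
    match_scalars <;> ring
  push Not at c0 c1 c2 c3
  -- What remains is the octahedron. Two planes through its diagonal from the midpoint of y_0 y_2 to
  -- that of y_1 y_3 cut it into the four inner tetrahedra, and the two signs select one of them.
  rcases le_total 0 (w 0 + w 1 - w 2 - w 3) with s | s <;>
    rcases le_total 0 (w 0 + w 3 - w 1 - w 2) with u | u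
  · refine key _ (Or.inr (Or.inr (Or.inr (Or.inr (Or.inl rfl))))) (w 0 + w 1 - w 2 - w 3)
      (2 * w 2) (w 0 + w 3 - w 1 - w 2) (1 - 2 * w 0)
      (by linarith) (by linarith) (by linarith) (by linarith) (by linarith) ?_
    simp [midpoint_eq_smul_add, e0]
    match_scalars <;> ring
  · refine key _ (Or.inr (Or.inr (Or.inr (Or.inr (Or.inr (Or.inl rfl))))))
      (w 0 + w 1 - w 2 - w 3) (1 - 2 * w 1) (-(w 0 + w 3 - w 1 - w 2)) (2 * w 3)
      (by linarith) (by linarith) (by linarith) (by linarith) (by linarith) ?_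
    simp [midpoint_eq_smul_add, e0]
    match_scalars <;> ring
  · refine key _ (Or.inr (Or.inr (Or.inr (Or.inr (Or.inr (Or.inr (Or.inl rfl)))))))
      (1 - 2 * w 3) (w 0 + w 3 - w 1 - w 2) (2 * w 1) (-(w 0 + w 1 - w 2 - w 3))
      (by linarith) (by linarith) (by linarith) (by linarith) (by linarith) ?_
    simp [midpoint_eq_smul_add, e0]
    match_scalars <;> ring
  · refine key _ (Or.inr (Or.inr (Or.inr (Or.inr (Or.inr (Or.inr (Or.inr rfl)))))))
      (2 * w 0) (-(w 0 + w 3 - w 1 - w 2)) (1 - 2 * w 2) (-(w 0 + w 1 - w 2 - w 3))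
      (by linarith) (by linarith) (by linarith) (by linarith) (by linarith) ?_
    simp [midpoint_eq_smul_add, e0]
    match_scalars <;> ring

lemma refine_cover (hn : n = 2 ∨ n = 3) (y : Fin (n + 1) → E n) {w : Fin (n + 1) → ℝ}
    (hw : w ∈ stdSimplex ℝ (Fin (n + 1))) (m : ℕ) :
    ∃ t ∈ refine m y, ∃ w' ∈ stdSimplex ℝ (Fin (n + 1)), ∑ k, w' k • t k = ∑ k, w k • y k := by
  induction m with
  | zero => exact ⟨y, rfl, w, hw, rfl⟩
  | succ m ih =>
    obtain ⟨t, ht, w', hw', e⟩ := ih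
    rw [← e]
    have : ∃ s ∈ subdivide t, ∃ w'' ∈ stdSimplex ℝ (Fin (n + 1)),
        ∑ k, w'' k • s k = ∑ k, w' k • t k := by
      rcases hn with rfl | rfl
      · exact subdivide_cover_two t hw'
      · exact subdivide_cover_three t hw'
    obtain ⟨s, hs, h⟩ := this
    exact ⟨s, mem_iUnion₂.2 ⟨t, ht, hs⟩, h⟩

/-! ### Barycentric coordinates of a macro-element -/

/-- The vertices of a macro-element as an affine basis. -/
def bary (T : Macro n) : AffineBasis (Fin (n + 1)) ℝ (E n) where
  toFun := T.points
  ind' := T.independent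
  tot' := T.independent.affineSpan_eq_top_iff_card_eq_finrank_add_one.2 (by simp)

/-- The barycentric coordinates. -/
def lam (T : Macro n) (k : Fin (n + 1)) : E n →ᵃ[ℝ] ℝ := (bary T).coord k

/-- The linear parts of the barycentric coordinates. -/
def dlam (T : Macro n) (k : Fin (n + 1)) : E n →ₗ[ℝ] ℝ := (lam T k).linear

lemma lam_sub (T : Macro n) (k) (x y : E n) : lam T k x - lam T k y = dlam T k (x - y) := by
  exact ((lam T k).linearMap_vsub x y).symm

lemma lam_add (T : Macro n) (k) (x v : E n) : lam T k (x + v) = lam T k x + dlam T k v := by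
  have := lam_sub T k (x + v) x
  rw [add_sub_cancel_left] at this
  linarith

lemma sum_lam (T : Macro n) (x : E n) : ∑ k, lam T k x = 1 := (bary T).sum_coord_apply_eq_one x

lemma sum_dlam (T : Macro n) (v : E n) : ∑ k, dlam T k v = 0 := by
  have h1 := sum_lam T (0 + v)
  simp only [lam_add, Finset.sum_add_distrib, sum_lam] at h1
  linarith

lemma sum_lam_smul (T : Macro n) (x : E n) : ∑ k, lam T k x • T.points k = x :=
  (bary T).linear_combination_coord_eq_self x

lemma sum_dlam_smul (T : Macro n) (v : E n) : ∑ k, dlam T k v • T.points k = v := by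
  have h1 := sum_lam_smul T (0 + v)
  simp only [lam_add, add_smul, Finset.sum_add_distrib, sum_lam_smul] at h1
  simpa using h1

lemma lam_sum_smul (T : Macro n) (k) {ι : Type*} (s : Finset ι) (w : ι → ℝ) (p : ι → E n)
    (hw : ∑ i ∈ s, w i = 1) : lam T k (∑ i ∈ s, w i • p i) = ∑ i ∈ s, w i * lam T k (p i) := by
  have h := fun x => lam_add T k 0 x
  simp only [zero_add] at h
  have e : ∑ i ∈ s, w i * lam T k (p i) = ∑ i ∈ s, w i * (lam T k 0 + dlam T k (p i)) :=
    Finset.sum_congr rfl fun i _ => by rw [h (p i)]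
  rw [h (∑ i ∈ s, w i • p i), e]
  simp only [map_sum, map_smul, mul_add, Finset.sum_add_distrib, ← Finset.sum_mul, hw, one_mul,
    smul_eq_mul]

lemma lam_point (T : Macro n) (k l) : lam T k (T.points l) = if k = l then 1 else 0 :=
  (bary T).coord_apply k l

lemma mem_closedInterior_iff {T : Macro n} {x : E n} :
    x ∈ T.closedInterior ↔ ∀ k, 0 ≤ lam T k x := by
  rw [← Affine.Simplex.convexHull_eq_closedInterior]
  change x ∈ convexHull ℝ (range (bary T)) ↔ _
  rw [(bary T).convexHull_eq_nonneg_coord]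
  rfl

lemma convex_closedInterior (T : Macro n) : Convex ℝ T.closedInterior := by
  rw [← Affine.Simplex.convexHull_eq_closedInterior]
  exact convex_convexHull _ _

lemma mem_interior_iff (hn : n ≠ 0) {T : Macro n} {x : E n} :
    x ∈ T.interior ↔ ∀ k, 0 < lam T k x := by
  have hx : x = Finset.univ.affineCombination ℝ T.points (fun k => lam T k x) :=
    ((bary T).affineCombination_coord_eq_self x).symm
  conv_lhs => rw [hx]
  rw [Affine.Simplex.affineCombination_mem_interior_iff (sum_lam T x)]
  refine ⟨fun h k => (h k).1, fun h k => ⟨h k, ?_⟩⟩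
  -- The interior of a simplex also requires coordinates below 1; this follows from the positivity
  -- of a second coordinate.
  have : Nontrivial (Fin (n + 1)) := Fin.nontrivial_iff_two_le.2 (by omega)
  obtain ⟨l, hl⟩ := exists_ne k
  have h1 : lam T k x + lam T l x ≤ ∑ k, lam T k x := by
    rw [← Finset.sum_pair (f := fun k => lam T k x) hl.symm]
    exact Finset.sum_le_sum_of_subset_of_nonneg (Finset.subset_univ _) fun i _ _ => (h i).le
  rw [sum_lam] at h1
  linarith [h l]

lemma interior_closedInterior (hn : n ≠ 0) (T : Macro n) :
    interior T.closedInterior = T.interior := by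
  rw [← Affine.Simplex.convexHull_eq_closedInterior]
  have := (bary T).interior_convexHull
  ext x
  rw [mem_interior_iff hn]
  exact Set.ext_iff.1 this x

lemma isOpen_interior (hn : n ≠ 0) (T : Macro n) : IsOpen T.interior := by
  rw [← interior_closedInterior hn]; exact _root_.isOpen_interior

lemma convex_interior (hn : n ≠ 0) (T : Macro n) : Convex ℝ T.interior := by
  rw [← interior_closedInterior hn]; exact (convex_closedInterior T).interior

lemma interior_nonempty (hn : n ≠ 0) (T : Macro n) : T.interior.Nonempty := by
  rw [← interior_closedInterior hn, ← Affine.Simplex.convexHull_eq_closedInterior]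
  exact ⟨_, (bary T).centroid_mem_interior_convexHull⟩

lemma isClosed_closedInterior (T : Macro n) : IsClosed T.closedInterior :=
  T.isClosed_closedInterior

lemma isBounded_closedInterior (T : Macro n) : Bornology.IsBounded T.closedInterior :=
  T.isCompact_closedInterior.isBounded

lemma closure_interior (hn : n ≠ 0) (T : Macro n) : closure T.interior = T.closedInterior := by
  rw [← interior_closedInterior hn,
    (convex_closedInterior T).closure_interior_eq_closure_of_nonempty_interior,
    (isClosed_closedInterior T).closure_eq]
  rw [interior_closedInterior hn]
  exact interior_nonempty hn T

lemma elemDiam_pos (hn : n ≠ 0) (T : Macro n) : 0 < elemDiam T := by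
  have : Nontrivial (Fin (n + 1)) := Fin.nontrivial_iff_two_le.2 (by omega)
  obtain ⟨l, hl⟩ := exists_ne (0 : Fin (n + 1))
  refine lt_of_lt_of_le (dist_pos.2 (T.independent.injective.ne hl)) ?_
  exact Metric.dist_le_diam_of_mem (isBounded_closedInterior T)
    (T.point_mem_closedInterior _) (T.point_mem_closedInterior _)

/-- A step of length at most ρ from the centre stays in the simplex, where barycentric coordinates
range over [0, 1]; the rest is scaling. The gradient bounds rest on this. -/
lemma abs_dlam_le_of_closedBall {T : Macro n} {z : E n} {ρ : ℝ} (hρ : 0 < ρ)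
    (h : Metric.closedBall z ρ ⊆ T.closedInterior) (k) (v : E n) :
    |dlam T k v| ≤ ‖v‖ / ρ := by
  rcases eq_or_ne v 0 with rfl | hv
  · simp
  have hv' : 0 < ‖v‖ := norm_pos_iff.2 hv
  have key : ∀ u : E n, ‖u‖ ≤ ρ → dlam T k u ≤ 1 := by
    intro u hu
    have h1 := mem_closedInterior_iff.1 (h (show z + u ∈ _ by simpa using hu))
    have h2 := mem_closedInterior_iff.1 (h (show z ∈ _ by simpa using hρ.le))
    have h3 : lam T k (z + u) ≤ 1 := by
      rw [← sum_lam T (z + u)]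
      exact Finset.single_le_sum (f := fun k => lam T k (z + u)) (fun i _ => h1 i)
        (Finset.mem_univ k)
    rw [lam_add] at h3
    linarith [h2 k]
  have e : ‖(ρ / ‖v‖) • v‖ ≤ ρ := by
    rw [norm_smul, Real.norm_of_nonneg (by positivity), div_mul_cancel₀ _ hv'.ne']
  have h1 := key _ e
  have h2 := key (-((ρ / ‖v‖) • v)) (by rwa [norm_neg])
  rw [map_neg, map_smul, smul_eq_mul] at h2
  rw [map_smul, smul_eq_mul] at h1
  rw [abs_le, le_div_iff₀ hρ, ← neg_div, div_le_iff₀ hρ]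
  have h3 : ρ / ‖v‖ * dlam T k v * ‖v‖ = dlam T k v * ρ := by field_simp
  constructor <;> nlinarith

/-! ### The lattice and the hat function of the uniform refinement -/

/-- Partial sums of the linear parts of the barycentric coordinates. -/
def tail (T : Macro n) (i : Fin (n + 1)) : E n →ₗ[ℝ] ℝ := ∑ k ∈ Finset.Ici i, dlam T k

/-- The functionals whose integer level sets bound the simplices of the refinement. -/
def wall (T : Macro n) (p : Fin (n + 1) × Fin (n + 1)) : E n →ₗ[ℝ] ℝ := tail T p.1 - tail T p.2

lemma tail_apply (T : Macro n) (i) (v : E n) : tail T i v = ∑ k ∈ Finset.Ici i, dlam T k v := by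
  simp [tail]

lemma tail_zero (T : Macro n) (v : E n) : tail T 0 v = 0 := by
  rw [tail_apply, ← sum_dlam T v]
  congr 1
  ext; simp

lemma tail_last (T : Macro n) (v : E n) : tail T (Fin.last n) v = dlam T (Fin.last n) v := by
  rw [tail_apply, ← Finset.sum_singleton (fun k => dlam T k v)]
  congr 1
  ext i; simp [Fin.last_le_iff]

lemma tail_castSucc (T : Macro n) (i : Fin n) (v : E n) :
    tail T i.castSucc v = dlam T i.castSucc v + tail T i.succ v := by
  rw [tail_apply, tail_apply, ← Finset.sum_insert (f := fun k => dlam T k v)]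
  · congr 1
    ext j; simp only [Finset.mem_Ici, Finset.mem_insert, Fin.le_def, Fin.ext_iff]; simp; omega
  · simp

lemma wall_apply (T : Macro n) (p) (v : E n) : wall T p v = tail T p.1 v - tail T p.2 v := rfl

/-- The largest value of the wall functionals. -/
def osc (T : Macro n) (v : E n) : ℝ :=
  Finset.univ.sup' ⟨(0, 0), Finset.mem_univ _⟩ fun p => wall T p v

/-- The hat function of the origin for the uniform refinement, extended to the whole space. -/
def hat (m : ℕ) (T : Macro n) (v : E n) : ℝ := max 0 (1 - 2 ^ m * osc T v)

lemma wall_le_osc (T : Macro n) (p) (v : E n) : wall T p v ≤ osc T v :=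
  Finset.le_sup' (fun p => wall T p v) (Finset.mem_univ p)

lemma osc_le {T : Macro n} {v : E n} {c : ℝ} (h : ∀ p, wall T p v ≤ c) : osc T v ≤ c :=
  Finset.sup'_le _ _ fun p _ => h p

lemma exists_osc_eq (T : Macro n) (v : E n) : ∃ p, osc T v = wall T p v := by
  obtain ⟨p, -, h⟩ := Finset.exists_mem_eq_sup' (s := Finset.univ)
    (⟨(0, 0), Finset.mem_univ _⟩ : (Finset.univ : Finset (Fin (n + 1) × Fin (n + 1))).Nonempty)
    (fun p => wall T p v)
  exact ⟨p, h⟩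

lemma osc_nonneg (T : Macro n) (v : E n) : 0 ≤ osc T v := by
  have := wall_le_osc T (0, 0) v
  simpa [wall_apply] using this

lemma osc_add_le (T : Macro n) (v w : E n) : osc T (v + w) ≤ osc T v + osc T w :=
  osc_le fun p => by rw [map_add]; exact add_le_add (wall_le_osc T p v) (wall_le_osc T p w)

lemma osc_neg (T : Macro n) (v : E n) : osc T (-v) = osc T v := by
  have key : ∀ v, osc T (-v) ≤ osc T v := fun v => osc_le fun p => by
    have := wall_le_osc T (p.2, p.1) v
    rw [wall_apply] at this
    rw [map_neg, wall_apply]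
    linarith
  exact le_antisymm (key v) (by simpa using key (-v))

lemma osc_zero (T : Macro n) : osc T (0 : E n) = 0 :=
  le_antisymm (osc_le fun p => by simp) (osc_nonneg _ _)

/-- Each coordinate is the difference of neighbouring tails, hence a wall. For the last one the
missing tail is replaced by `tail T 0`, which vanishes. -/
lemma abs_dlam_le_osc (T : Macro n) (k) (v : E n) : |dlam T k v| ≤ osc T v := by
  have key : ∀ v, dlam T k v ≤ osc T v := by
    intro v
    cases k using Fin.lastCases with
    | last =>
      have := wall_le_osc T (Fin.last n, 0) v
      rw [wall_apply, tail_zero, tail_last] at this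
      linarith
    | cast i =>
      have := wall_le_osc T (i.castSucc, i.succ) v
      rw [wall_apply] at this
      simp only [tail_castSucc] at this
      linarith
  have h := key (-v)
  rw [osc_neg, map_neg] at h
  exact abs_le.2 ⟨by linarith, key v⟩

lemma osc_le_of_abs_dlam_le {T : Macro n} {v : E n} {c : ℝ} (h : ∀ k, |dlam T k v| ≤ c) :
    osc T v ≤ 2 * (n + 1) * c := by
  have hc : 0 ≤ c := (abs_nonneg _).trans (h 0)
  have key : ∀ i, |tail T i v| ≤ (n + 1) * c := by
    intro i
    rw [tail_apply]
    calc |∑ k ∈ Finset.Ici i, dlam T k v| ≤ ∑ k ∈ Finset.Ici i, |dlam T k v| :=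
          Finset.abs_sum_le_sum_abs _ _
      _ ≤ ∑ k, |dlam T k v| :=
          Finset.sum_le_sum_of_subset_of_nonneg (Finset.subset_univ _) fun _ _ _ => abs_nonneg _
      _ ≤ ∑ k : Fin (n + 1), c := Finset.sum_le_sum fun k _ => h k
      _ = (n + 1) * c := by simp
  refine osc_le fun p => ?_
  rw [wall_apply]
  have h1 := abs_le.1 (key p.1)
  have h2 := abs_le.1 (key p.2)
  linarith

/-- As the coordinates of v sum to zero, v is a combination of the edge vectors at vertex 0. This
makes `osc` definite and bounds the support of `hat`. -/
lemma norm_le_osc (T : Macro n) (v : E n) : ‖v‖ ≤ (n + 1) * elemDiam T * osc T v := by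
  have e : v = ∑ k, dlam T k v • (T.points k - T.points 0) := by
    simp only [smul_sub, Finset.sum_sub_distrib, sum_dlam_smul, ← Finset.sum_smul, sum_dlam]
    simp
  calc ‖v‖ = ‖∑ k, dlam T k v • (T.points k - T.points 0)‖ := by rw [← e]
    _ ≤ ∑ k, ‖dlam T k v • (T.points k - T.points 0)‖ := norm_sum_le _ _
    _ ≤ ∑ k : Fin (n + 1), osc T v * elemDiam T := by
        refine Finset.sum_le_sum fun k _ => ?_
        rw [norm_smul, Real.norm_eq_abs, ← dist_eq_norm]
        exact mul_le_mul (abs_dlam_le_osc T k v)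
          (Metric.dist_le_diam_of_mem (isBounded_closedInterior T)
            (T.point_mem_closedInterior _) (T.point_mem_closedInterior _)) dist_nonneg
          (osc_nonneg T v)
    _ = (n + 1) * elemDiam T * osc T v := by simp; ring

lemma eq_zero_of_osc_nonpos {T : Macro n} {v : E n} (h : osc T v ≤ 0) : v = 0 := by
  have h0 : osc T v = 0 := le_antisymm h (osc_nonneg T v)
  have := norm_le_osc T v
  rw [h0, mul_zero] at this
  exact norm_le_zero_iff.1 this

lemma hat_nonneg (m : ℕ) (T : Macro n) (v : E n) : 0 ≤ hat m T v := le_max_left _ _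

lemma hat_ne_zero_iff {m : ℕ} {T : Macro n} {v : E n} :
    hat m T v ≠ 0 ↔ 2 ^ m * osc T v < 1 := by
  unfold hat
  constructor
  · intro h
    by_contra! h'
    exact h (max_eq_left (by linarith))
  · intro h
    exact (lt_of_lt_of_le (by linarith) (le_max_right _ _)).ne'

lemma mem_lattice_iff {m : ℕ} {T : Macro n} {x : E n} :
    x ∈ lattice m T ↔ ∀ k, ∃ a : ℕ, 2 ^ m * lam T k x = a := by
  have h2 : (2 : ℝ) ^ m ≠ 0 := by positivity
  constructor
  · rintro ⟨a, ha, rfl⟩ k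
    refine ⟨a k, ?_⟩
    have h1 : ∑ i, (a i : ℝ) / 2 ^ m = 1 := by
      rw [← Finset.sum_div, div_eq_one_iff_eq h2]
      exact_mod_cast ha
    rw [lam_sum_smul T k _ _ _ h1]
    simp only [lam_point]
    simp
    field_simp
  · intro h
    choose a ha using h
    refine ⟨a, ?_, ?_⟩
    · have : ((∑ i, a i : ℕ) : ℝ) = 2 ^ m := by
        push_cast
        rw [← Finset.sum_congr rfl fun i _ => ha i, ← Finset.mul_sum, sum_lam, mul_one]
      exact_mod_cast this
    · conv_lhs => rw [← sum_lam_smul T x]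
      refine Finset.sum_congr rfl fun i _ => ?_
      rw [← ha, mul_div_cancel_left₀ _ h2]

lemma lattice_subset_closedInterior (m : ℕ) (T : Macro n) : lattice m T ⊆ T.closedInterior := by
  intro x hx
  refine mem_closedInterior_iff.2 fun k => ?_
  obtain ⟨a, ha⟩ := mem_lattice_iff.1 hx k
  have : 0 ≤ 2 ^ m * lam T k x := by rw [ha]; positivity
  exact nonneg_of_mul_nonneg_right this (by positivity)

lemma exists_int_dlam {m : ℕ} {T : Macro n} {x y : E n} (hx : x ∈ lattice m T)
    (hy : y ∈ lattice m T) (k) : ∃ a : ℤ, 2 ^ m * dlam T k (x - y) = a := by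
  obtain ⟨a, ha⟩ := mem_lattice_iff.1 hx k
  obtain ⟨b, hb⟩ := mem_lattice_iff.1 hy k
  exact ⟨a - b, by rw [← lam_sub, mul_sub, ha, hb]; push_cast; ring⟩

lemma exists_int_tail {m : ℕ} {T : Macro n} {x y : E n} (hx : x ∈ lattice m T)
    (hy : y ∈ lattice m T) (i) : ∃ a : ℤ, 2 ^ m * tail T i (x - y) = a := by
  choose a ha using exists_int_dlam hx hy
  refine ⟨∑ k ∈ Finset.Ici i, a k, ?_⟩
  rw [tail_apply, Finset.mul_sum]
  push_cast
  exact Finset.sum_congr rfl fun k _ => ha k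

lemma exists_int_wall {m : ℕ} {T : Macro n} {x y : E n} (hx : x ∈ lattice m T)
    (hy : y ∈ lattice m T) (p) : ∃ a : ℤ, 2 ^ m * wall T p (x - y) = a := by
  obtain ⟨a, ha⟩ := exists_int_tail hx hy p.1
  obtain ⟨b, hb⟩ := exists_int_tail hx hy p.2
  exact ⟨a - b, by rw [wall_apply, mul_sub, ha, hb]; push_cast; ring⟩

/-- Between lattice points 2^m `osc` is an integer, so below 1 means nonpositive, which forces the
points to coincide. -/
lemma hat_sub_of_mem_lattice {m : ℕ} {T : Macro n} {x y : E n} (hx : x ∈ lattice m T)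
    (hy : y ∈ lattice m T) : hat m T (x - y) = indicator {y} (fun _ => (1 : ℝ)) x := by
  by_cases h : x = y
  · subst h; simp [hat, osc_zero]
  rw [indicator_of_notMem (by simpa using h)]
  by_contra h'
  rw [← ne_eq, hat_ne_zero_iff] at h'
  obtain ⟨p, hp⟩ := exists_osc_eq T (x - y)
  obtain ⟨a, ha⟩ := exists_int_wall hx hy p
  rw [hp, ha] at h'
  have h1 : a ≤ 0 := by
    have : a < 1 := by exact_mod_cast h'
    omega
  refine h (sub_eq_zero.1 (eq_zero_of_osc_nonpos (T := T) ?_))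
  rw [hp]
  have h2 : (2 : ℝ) ^ m * wall T p (x - y) ≤ 0 := by rw [ha]; exact_mod_cast h1
  exact nonpos_of_mul_nonpos_right h2 (by positivity)

lemma lattice_of_mem_refine (hn : n = 2 ∨ n = 3) {m : ℕ} {T : Macro n}
    {t : Fin (n + 1) → E n} (ht : t ∈ refine m T.points) (k) : t k ∈ lattice m T := by
  refine mem_lattice_iff.2 fun l => ?_
  have hc : Consecutive (fun k : Fin (n + 1) => if l = k then (1 : ℤ) else 0) := by
    refine ⟨⟨0, fun k => by dsimp only; split_ifs <;> simp⟩, ?_⟩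
    intro a b c d h1 h2 h3
    dsimp only
    split_ifs <;> simp <;> omega
  obtain ⟨z, hz, -⟩ := refine_consecutive hn (lam T l) (y := T.points)
    (fun k => by rw [lam_point]; split_ifs <;> simp) hc m t ht
  have h0 : 0 ≤ lam T l (t k) := mem_closedInterior_iff.1
    (refine_vertex_mem (convex_closedInterior T) T.point_mem_closedInterior m t ht k) l
  have h1 : 0 ≤ z k := by
    have : (0 : ℝ) ≤ z k := by rw [← hz]; positivity
    exact_mod_cast this
  refine ⟨(z k).toNat, ?_⟩
  rw [hz]
  exact_mod_cast (Int.toNat_of_nonneg h1).symm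

/-- On the vertices of T a wall is, up to sign and an additive constant, the indicator of an
interval of indices, so it does not alternate and `refine_consecutive` applies. Changing the base
point from vertex 0 to y shifts the values by an integer. -/
lemma wall_mem_refine (hn : n = 2 ∨ n = 3) {m : ℕ} {T : Macro n} {t : Fin (n + 1) → E n}
    (ht : t ∈ refine m T.points) {y : E n} (hy : y ∈ lattice m T) (p) :
    ∃ a : ℤ, ∀ k, 2 ^ m * wall T p (t k - y) = a ∨ 2 ^ m * wall T p (t k - y) = a + 1 := by
  let f : E n →ᵃ[ℝ] ℝ := (wall T p).toAffineMap - AffineMap.const ℝ (E n) (wall T p (T.points 0))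
  have hf : ∀ x, f x = wall T p (x - T.points 0) := fun x => by simp [f]
  have htail : ∀ i l, tail T i (T.points l - T.points 0) =
      (if i ≤ l then 1 else 0) - if i = 0 then 1 else 0 := by
    intro i l
    simp only [tail_apply, ← lam_sub, lam_point, Finset.sum_sub_distrib]
    simp
  let z : Fin (n + 1) → ℤ := fun l => ((if p.1 ≤ l then 1 else 0) - if p.1 = 0 then 1 else 0) -
    ((if p.2 ≤ l then 1 else 0) - if p.2 = 0 then 1 else 0)
  have hz : ∀ l, f (T.points l) = z l := by
    intro l
    rw [hf, wall_apply, htail, htail]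
    simp [z]
  have hc : Consecutive z := by
    constructor
    · rcases le_total p.1 p.2 with h | h
      · refine ⟨(if p.2 = 0 then 1 else 0) - (if p.1 = 0 then 1 else 0), fun l => ?_⟩
        simp only [z]
        split_ifs <;> omega
      · refine ⟨(if p.2 = 0 then 1 else 0) - (if p.1 = 0 then 1 else 0) - 1, fun l => ?_⟩
        simp only [z]
        split_ifs <;> omega
    · intro a b c d h1 h2 h3
      simp only [z]
      split_ifs <;> omega
  obtain ⟨z', h1, ⟨a, ha⟩, -⟩ := refine_consecutive hn f hz hc m t ht
  have h0 : T.points 0 ∈ lattice m T := by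
    refine mem_lattice_iff.2 fun k => ?_
    rw [lam_point]
    split_ifs
    · exact ⟨2 ^ m, by simp⟩
    · exact ⟨0, by simp⟩
  obtain ⟨b, hb⟩ := exists_int_wall hy h0 p
  refine ⟨a - b, fun k => ?_⟩
  have e : 2 ^ m * wall T p (t k - y) = z' k - b := by
    rw [← h1, hf, ← hb, ← mul_sub, ← map_sub]
    congr 2
    abel
  rw [e]
  rcases ha k with h | h <;> rw [h]
  · left; push_cast; ring
  · right; push_cast; ring

/-- On every simplex of the refinement the hat function is affine. -/
lemma hat_affine (hn : n = 2 ∨ n = 3) {m : ℕ} {T : Macro n} {t : Fin (n + 1) → E n}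
    (ht : t ∈ refine m T.points) {y : E n} (hy : y ∈ lattice m T) {w : Fin (n + 1) → ℝ}
    (hw : w ∈ stdSimplex ℝ (Fin (n + 1))) :
    hat m T (∑ k, w k • t k - y) = ∑ k, w k * indicator {y} (fun _ => (1 : ℝ)) (t k) := by
  have h2 : (0 : ℝ) < 2 ^ m := by positivity
  have hsub : ∀ k, indicator {y} (fun _ => (1 : ℝ)) (t k) = hat m T (t k - y) := fun k =>
    (hat_sub_of_mem_lattice (lattice_of_mem_refine hn ht k) hy).symm
  simp only [hsub]
  have hv : ∑ k, w k • t k - y = ∑ k, w k • (t k - y) := by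
    simp only [smul_sub, Finset.sum_sub_distrib, ← Finset.sum_smul, hw.2, one_smul]
  rw [hv]
  set u : Fin (n + 1) → E n := fun k => t k - y with hu
  change hat m T (∑ k, w k • u k) = ∑ k, w k * hat m T (u k)
  have hwall : ∀ p, wall T p (∑ k, w k • u k) = ∑ k, w k * wall T p (u k) := fun p => by simp
  -- a functional that is nonnegative at the point is so at the vertices that carry it
  have hpos : ∀ p, 0 ≤ wall T p (∑ k, w k • u k) → ∀ k, 0 < w k → 0 ≤ wall T p (u k) := by
    intro p hp k hk
    -- Negativity at one vertex pushes the lower integer to -1 or below, so the functional is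
    -- nonpositive at all vertices and negative at one with positive weight, against its sign at the
    -- point.
    obtain ⟨a, ha⟩ := wall_mem_refine hn ht hy p
    by_contra! hneg
    have hneg' : 2 ^ m * wall T p (u k) < 0 := mul_neg_of_pos_of_neg h2 hneg
    have ha1 : a + 1 ≤ 0 := by
      have : a < 0 := by
        rcases ha k with h | h
        · have : (a : ℝ) < 0 := by rw [← h]; exact hneg'
          exact_mod_cast this
        · have : (a : ℝ) + 1 < 0 := by rw [← h]; exact hneg'
          have : a + 1 < 0 := by exact_mod_cast this
          omega
      omega
    have ha1' : (a : ℝ) + 1 ≤ 0 := by exact_mod_cast ha1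
    have hall : ∀ l, wall T p (u l) ≤ 0 := fun l =>
      nonpos_of_mul_nonpos_right (b := wall T p (u l)) (a := 2 ^ m)
        (by rcases ha l with h | h <;> simp only [hu] <;> rw [h] <;> linarith) h2
    have : ∑ l, w l * wall T p (u l) < 0 := by
      refine Finset.sum_neg' (fun l _ => mul_nonpos_of_nonneg_of_nonpos (hw.1 l) (hall l))
        ⟨k, Finset.mem_univ k, mul_neg_of_pos_of_neg hk hneg⟩
    rw [← hwall] at this
    linarith
  obtain ⟨p, hp⟩ := exists_osc_eq T (∑ k, w k • u k)
  -- The pair p maximizes at the point, so its first tail is the largest and its second the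
  -- smallest; `hpos` carries both comparisons to the vertices.
  have hmax : ∀ k, 0 < w k → osc T (u k) = wall T p (u k) := by
    intro k hk
    refine le_antisymm (osc_le fun q => ?_) (wall_le_osc T p _)
    have h1 : 0 ≤ wall T (p.1, q.1) (u k) := by
      refine hpos _ ?_ k hk
      have := wall_le_osc T (q.1, p.2) (∑ k, w k • u k)
      rw [hp] at this
      simp only [wall_apply] at this ⊢
      linarith
    have h3 : 0 ≤ wall T (q.2, p.2) (u k) := by
      refine hpos _ ?_ k hk
      have := wall_le_osc T (p.1, q.2) (∑ k, w k • u k)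
      rw [hp] at this
      simp only [wall_apply] at this ⊢
      linarith
    simp only [wall_apply] at h1 h3 ⊢
    linarith
  obtain ⟨a, ha⟩ := wall_mem_refine hn ht hy p
  have hsum : 1 - 2 ^ m * osc T (∑ k, w k • u k) = ∑ k, w k * (1 - 2 ^ m * wall T p (u k)) := by
    simp only [hp, hwall, mul_sub, Finset.sum_sub_distrib, mul_one, hw.2, Finset.mul_sum]
    congr 1
    exact Finset.sum_congr rfl fun k _ => by ring
  unfold hat
  rw [hsum]
  -- The two consecutive values are both at most 1 or both at least 1, so the truncation at zero is
  -- either inactive or total on the whole simplex.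
  rcases le_or_gt a 0 with h | h
  · have h' : (a : ℝ) ≤ 0 := by exact_mod_cast h
    have e : ∀ k, 0 ≤ 1 - 2 ^ m * wall T p (u k) := fun k => by
      rcases ha k with h | h <;> simp only [hu] <;> rw [h] <;> linarith
    rw [max_eq_right (Finset.sum_nonneg fun k _ => mul_nonneg (hw.1 k) (e k))]
    refine Finset.sum_congr rfl fun k _ => ?_
    rcases (hw.1 k).eq_or_lt with h0 | h0
    · simp [← h0]
    · rw [hmax k h0, max_eq_right (e k)]
  · have h' : (1 : ℝ) ≤ a := by exact_mod_cast h
    have e : ∀ k, 1 - 2 ^ m * wall T p (u k) ≤ 0 := fun k => by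
      rcases ha k with h | h <;> simp only [hu] <;> rw [h] <;> linarith
    rw [max_eq_left (Finset.sum_nonpos fun k _ => mul_nonpos_of_nonneg_of_nonpos (hw.1 k) (e k))]
    refine (Finset.sum_eq_zero fun k _ => ?_).symm
    rcases (hw.1 k).eq_or_lt with h0 | h0
    · simp [← h0]
    · rw [hmax k h0, max_eq_left (e k), mul_zero]

/-! ### Vertex functions near interior lattice points -/

/-- A closed element is the closure of its interior, so a neighbourhood of x inside T would meet the
interior of T'. -/
lemma IsMacroMesh.eq_of_mem_interior (hn : n ≠ 0) {Ω : Set (E n)} {Th : Set (Macro n)}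
    (h : IsMacroMesh Ω Th) {T T' : Macro n} (hT : T ∈ Th) (hT' : T' ∈ Th) {x : E n}
    (hx : x ∈ T.interior) (hx' : x ∈ T'.closedInterior) : T' = T := by
  by_contra hne
  rw [← closure_interior hn, mem_closure_iff] at hx'
  obtain ⟨y, hy, hy'⟩ := hx' _ (isOpen_interior hn T) hx
  exact disjoint_left.1 (h.disjoint T' hT' T hT hne) hy' hy

lemma IsMacroMesh.interior_subset (hn : n ≠ 0) {Ω : Set (E n)} {Th : Set (Macro n)}
    (h : IsMacroMesh Ω Th) {T : Macro n} (hT : T ∈ Th) : T.interior ⊆ Ω := by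
  rw [← h.regular, ← interior_closedInterior hn]
  refine interior_mono ?_
  rw [h.cover]
  exact subset_biUnion_of_mem (u := fun T : Macro n => T.closedInterior) hT

lemma sum_smul_mem_closedInterior {m : ℕ} {T : Macro n} {t : Fin (n + 1) → E n}
    (ht : t ∈ refine m T.points) {w : Fin (n + 1) → ℝ} (hw : w ∈ stdSimplex ℝ (Fin (n + 1))) :
    ∑ k, w k • t k ∈ T.closedInterior :=
  (convex_closedInterior T).sum_mem (fun k _ => hw.1 k) hw.2 fun k _ =>
    refine_vertex_mem (convex_closedInterior T) T.point_mem_closedInterior m t ht k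

/-- The values over which `vertexFn` takes the supremum. -/
def vertexValues (S : Set (Fin (n + 1) → E n)) (z x : E n) : Set ℝ :=
  {c | ∃ t ∈ S, ∃ w ∈ stdSimplex ℝ (Fin (n + 1)), ∑ k, w k • t k = x ∧
    c = ∑ k, w k * indicator {z} (fun _ => (1 : ℝ)) (t k)}

lemma vertexFn_nonneg (S : Set (Fin (n + 1) → E n)) (z x : E n) : 0 ≤ vertexFn S z x := by
  refine Real.sSup_nonneg ?_
  rintro c ⟨t, -, w, hw, -, rfl⟩
  exact Finset.sum_nonneg fun k _ => mul_nonneg (hw.1 k)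
    (indicator_nonneg (fun _ _ => zero_le_one) _)

/-- Only refined simplices of T itself reach an interior point of T. The supremum in `vertexFn` thus
becomes local, and `refine_cover` shows that it is not over the empty set. -/
lemma vertexValues_eq (hn : n = 2 ∨ n = 3) {Ω : Set (E n)} {Th : Set (Macro n)}
    (h : IsMacroMesh Ω Th) {m : ℕ} {T : Macro n} (hT : T ∈ Th)
    {x z : E n} (hx : x ∈ T.interior) :
    (vertexValues (fineMesh Th m) z x).Nonempty ∧ ∀ c ∈ vertexValues (fineMesh Th m) z x,
      ∃ t ∈ refine m T.points, ∃ w ∈ stdSimplex ℝ (Fin (n + 1)), ∑ k, w k • t k = x ∧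
        c = ∑ k, w k * indicator {z} (fun _ => (1 : ℝ)) (t k) := by
  have hn0 : n ≠ 0 := by omega
  constructor
  · have hw : (fun k => lam T k x) ∈ stdSimplex ℝ (Fin (n + 1)) :=
      ⟨fun k => ((mem_interior_iff hn0).1 hx k).le, sum_lam T x⟩
    obtain ⟨t, ht, w, hw, e⟩ := refine_cover hn T.points hw m
    rw [sum_lam_smul] at e
    exact ⟨_, t, mem_iUnion₂.2 ⟨T, hT, ht⟩, w, hw, e, rfl⟩
  · rintro c ⟨t, ht, w, hw, e, rfl⟩
    obtain ⟨T', hT', ht⟩ := mem_iUnion₂.1 ht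
    have : x ∈ T'.closedInterior := by rw [← e]; exact sum_smul_mem_closedInterior ht hw
    obtain rfl := h.eq_of_mem_interior hn0 hT hT' hx this
    exact ⟨t, ht, w, hw, e, rfl⟩

lemma vertexFn_eq_hat (hn : n = 2 ∨ n = 3) {Ω : Set (E n)} {Th : Set (Macro n)}
    (h : IsMacroMesh Ω Th) {m : ℕ} {T : Macro n} (hT : T ∈ Th)
    {x z : E n} (hx : x ∈ T.interior) (hz : z ∈ lattice m T) :
    vertexFn (fineMesh Th m) z x = hat m T (x - z) := by
  obtain ⟨hne, hv⟩ := vertexValues_eq hn h (m := m) hT (z := z) hx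
  have : vertexValues (fineMesh Th m) z x = {hat m T (x - z)} := by
    refine hne.subset_singleton_iff.1 fun c hc => ?_
    obtain ⟨t, ht, w, hw, rfl, rfl⟩ := hv c hc
    exact (hat_affine hn ht hz hw).symm
  change sSup (vertexValues (fineMesh Th m) z x) = _
  rw [this, csSup_singleton]

lemma vertexFn_eq_zero (hn : n = 2 ∨ n = 3) {Ω : Set (E n)} {Th : Set (Macro n)}
    (h : IsMacroMesh Ω Th) {m : ℕ} {T : Macro n} (hT : T ∈ Th)
    {x z : E n} (hx : x ∈ T.interior) (hz : z ∉ lattice m T) :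
    vertexFn (fineMesh Th m) z x = 0 := by
  obtain ⟨hne, hv⟩ := vertexValues_eq hn h (m := m) hT (z := z) hx
  have : vertexValues (fineMesh Th m) z x = {0} := by
    refine hne.subset_singleton_iff.1 fun c hc => ?_
    obtain ⟨t, ht, w, hw, rfl, rfl⟩ := hv c hc
    refine Finset.sum_eq_zero fun k _ => ?_
    rw [indicator_of_notMem, mul_zero]
    rintro rfl
    exact hz (lattice_of_mem_refine hn ht k)
  change sSup (vertexValues (fineMesh Th m) z x) = _
  rw [this, csSup_singleton]

/-- At an interior lattice point every scaled coordinate is at least 1, and on the support of the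
hat it changes by less than 1. -/
lemma mem_interior_of_hat_ne_zero (hn : n = 2 ∨ n = 3) {m : ℕ} {T : Macro n}
    {x z : E n} (hz : z ∈ latticeInterior m T)
    (hx : hat m T (x - z) ≠ 0) : x ∈ T.interior := by
  have hn0 : n ≠ 0 := by omega
  have h2 : (0 : ℝ) < 2 ^ m := by positivity
  rw [mem_interior_iff hn0]
  intro k
  obtain ⟨a, ha⟩ := mem_lattice_iff.1 hz.1 k
  have hpos := (mem_interior_iff hn0).1 hz.2 k
  have ha1 : (1 : ℝ) ≤ a := by
    have : (0 : ℝ) < a := by rw [← ha]; positivity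
    exact_mod_cast this
  rw [hat_ne_zero_iff] at hx
  have h3 := abs_le.1 (abs_dlam_le_osc T k (x - z))
  rw [← lam_sub] at h3
  have : 0 < 2 ^ m * lam T k x := by nlinarith
  exact pos_of_mul_pos_right this h2.le

/-- Off T the hat vanishes. A simplex with z among its vertices must come from T, where `hat_affine`
gives zero; all other simplices contribute zero anyway. -/
lemma vertexFn_eq_hat_of_latticeInterior (hn : n = 2 ∨ n = 3) {Ω : Set (E n)} {Th : Set (Macro n)}
    (h : IsMacroMesh Ω Th) {m : ℕ} {T : Macro n} (hT : T ∈ Th)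
    {z : E n} (hz : z ∈ latticeInterior m T) (x : E n) :
    vertexFn (fineMesh Th m) z x = hat m T (x - z) := by
  have hn0 : n ≠ 0 := by omega
  by_cases hx : x ∈ T.interior
  · exact vertexFn_eq_hat hn h hT hx hz.1
  have h0 : hat m T (x - z) = 0 := by
    by_contra h'
    exact hx (mem_interior_of_hat_ne_zero hn hz h')
  rw [h0]
  refine le_antisymm (Real.sSup_nonpos ?_) (vertexFn_nonneg _ _ _)
  rintro c ⟨t, ht, w, hw, rfl, rfl⟩
  obtain ⟨T', hT', ht⟩ := mem_iUnion₂.1 ht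
  by_cases hk : ∃ k, t k = z
  · obtain ⟨k, rfl⟩ := hk
    obtain rfl := h.eq_of_mem_interior hn0 hT hT' hz.2
      (lattice_subset_closedInterior m T' (lattice_of_mem_refine hn ht k))
    rw [← hat_affine hn ht hz.1 hw, h0]
  · push Not at hk
    refine (Finset.sum_eq_zero fun k _ => ?_).le
    rw [indicator_of_notMem (by simpa using hk k), mul_zero]

/-- Differences of lattice points whose hat functions overlap. -/
def IsNeighbor (m : ℕ) (T : Macro n) (δ : E n) : Prop :=
  (∃ y ∈ lattice m T, ∃ y' ∈ lattice m T, δ = y' - y) ∧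
    ∃ v, hat m T v ≠ 0 ∧ hat m T (v - δ) ≠ 0

lemma IsNeighbor.neg {m : ℕ} {T : Macro n} {δ : E n} (h : IsNeighbor m T δ) :
    IsNeighbor m T (-δ) := by
  obtain ⟨⟨y, hy, y', hy', rfl⟩, v, h1, h2⟩ := h
  exact ⟨⟨y', hy', y, hy, by abel⟩, v - (y' - y), h2, by rwa [sub_neg_eq_add, sub_add_cancel]⟩

/-- Overlapping hats give 2^m `osc` δ < 2, so an integer coordinate drops by at most 1, starting
from at least 1. -/
lemma IsNeighbor.add_mem_lattice (hn : n ≠ 0) {m : ℕ} {T : Macro n} {δ z : E n}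
    (h : IsNeighbor m T δ) (hz : z ∈ latticeInterior m T) : z + δ ∈ lattice m T := by
  obtain ⟨⟨y, hy, y', hy', rfl⟩, v, h1, h2⟩ := h
  rw [hat_ne_zero_iff] at h1 h2
  have h2m : (0 : ℝ) < 2 ^ m := by positivity
  refine mem_lattice_iff.2 fun k => ?_
  obtain ⟨a, ha⟩ := mem_lattice_iff.1 hz.1 k
  obtain ⟨b, hb⟩ := exists_int_dlam hy' hy k
  have hpos := (mem_interior_iff hn).1 hz.2 k
  have ha1 : 1 ≤ (a : ℤ) := by
    have : (0 : ℝ) < a := by rw [← ha]; positivity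
    have : 0 < a := by exact_mod_cast this
    omega
  have h3 : osc T (y' - y) ≤ osc T v + osc T (v - (y' - y)) := by
    have := osc_add_le T v (-(v - (y' - y)))
    rw [osc_neg] at this
    convert this using 2
    abel
  have hb1 : -2 < b := by
    have h4 := abs_le.1 (abs_dlam_le_osc T k (y' - y))
    have : (-2 : ℝ) < b := by rw [← hb]; nlinarith
    exact_mod_cast this
  refine ⟨(a + b).toNat, ?_⟩
  rw [lam_add, mul_add, ha, hb]
  have : ((a + b).toNat : ℤ) = a + b := Int.toNat_of_nonneg (by omega)
  exact_mod_cast this.symm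

lemma isNeighbor_of_overlap (hn : n = 2 ∨ n = 3) {Ω : Set (E n)} {Th : Set (Macro n)}
    (h : IsMacroMesh Ω Th) {m : ℕ} {T : Macro n} (hT : T ∈ Th)
    {x x' : E n} (hx : x ∈ latticeInterior m T)
    (ho : (Function.support (vertexFn (fineMesh Th m) x) ∩
      Function.support (vertexFn (fineMesh Th m) x')).Nonempty) :
    x' ∈ lattice m T ∧ IsNeighbor m T (x' - x) := by
  obtain ⟨p, hp, hp'⟩ := ho
  rw [Function.mem_support, vertexFn_eq_hat_of_latticeInterior hn h hT hx] at hp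
  have hpT := mem_interior_of_hat_ne_zero hn hx hp
  have hx' : x' ∈ lattice m T := by
    by_contra hx'
    exact hp' (vertexFn_eq_zero hn h hT hpT hx')
  rw [Function.mem_support, vertexFn_eq_hat hn h hT hpT hx'] at hp'
  refine ⟨hx', ⟨x, hx.1, x', hx', rfl⟩, p - x, hp, ?_⟩
  convert hp' using 2
  abel

lemma isNeighbor_of_mem_translations (hn : n = 2 ∨ n = 3) {Ω : Set (E n)} {Th : Set (Macro n)}
    (h : IsMacroMesh Ω Th) {m : ℕ} {T : Macro n} (hT : T ∈ Th)
    {δ : E n} (hδ : δ ∈ translations Th m T) :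
    IsNeighbor m T δ := by
  obtain ⟨x, hx, x', -, rfl, ho⟩ := hδ
  exact (isNeighbor_of_overlap hn h hT hx ho).2

/-- Overlap is decided by `hat` alone, so every interior lattice point serves as witness: the
stencil is the same at all of them. -/
lemma mem_translations_of_isNeighbor (hn : n = 2 ∨ n = 3) {Ω : Set (E n)} {Th : Set (Macro n)}
    (h : IsMacroMesh Ω Th) {m : ℕ} {T : Macro n} (hT : T ∈ Th)
    {δ z : E n} (hδ : IsNeighbor m T δ)
    (hz : z ∈ latticeInterior m T) : δ ∈ translations Th m T := by
  have hn0 : n ≠ 0 := by omega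
  have hz' := hδ.add_mem_lattice hn0 hz
  obtain ⟨-, v, h1, h2⟩ := hδ
  refine ⟨z, hz, z + δ, mem_iUnion₂.2 ⟨T, hT, hz'⟩, by simp, z + v, ?_, ?_⟩
  · rw [Function.mem_support, vertexFn_eq_hat_of_latticeInterior hn h hT hz]
    simpa using h1
  · have : z + v ∈ T.interior := mem_interior_of_hat_ne_zero hn hz (by simpa using h1)
    rw [Function.mem_support, vertexFn_eq_hat hn h hT this hz']
    simpa using h2

/-! ### Matrix entries as values of stencil functions -/

/-- Zeros of a nonnegative function are minima. The integrands therefore vanish pointwise off the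
common support, with no exceptional null set. -/
lemma gradient_eq_zero_of_nonneg {f : E n → ℝ} (hf : ∀ x, 0 ≤ f x) {x : E n} (hx : f x = 0) :
    gradient f x = 0 := by
  have : IsLocalMin f x := Filter.Eventually.of_forall fun y => by rw [hx]; exact hf y
  rw [gradient, this.fderiv_eq_zero, map_zero]

lemma gradient_sub_const (f : E n → ℝ) (a x : E n) :
    gradient (fun y => f (y - a)) x = gradient f (x - a) := by
  rw [gradient, gradient, fderiv_comp_sub]

lemma gradient_congr {f g : E n → ℝ} {x : E n} (h : f =ᶠ[nhds x] g) :
    gradient f x = gradient g x := by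
  rw [gradient, gradient, h.fderiv_eq]

lemma flux_zero_left (M : Matrix (Fin n) (Fin n) ℝ) (r : E n) : flux M 0 r = 0 := by simp [flux]

lemma flux_zero_right (M : Matrix (Fin n) (Fin n) ℝ) (p : E n) : flux M p 0 = 0 := by simp [flux]

lemma continuous_osc (T : Macro n) : Continuous (osc T) := by
  unfold osc
  exact Continuous.finset_sup'_apply _ fun p _ => (wall T p).continuous_of_finiteDimensional

lemma continuous_hat (m : ℕ) (T : Macro n) : Continuous (hat m T) := by
  unfold hat
  exact continuous_const.max (continuous_const.sub (continuous_const.mul (continuous_osc T)))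

lemma mem_overlap_hat {m : ℕ} {T : Macro n} {δ y : E n} :
    y ∈ overlap (hat m T) δ ↔ hat m T y ≠ 0 ∧ hat m T (y - δ) ≠ 0 := Iff.rfl

lemma isOpen_overlap_hat (m : ℕ) (T : Macro n) (δ : E n) : IsOpen (overlap (hat m T) δ) :=
  (isOpen_ne_fun (continuous_hat m T) continuous_const).inter
    (isOpen_ne_fun ((continuous_hat m T).comp (continuous_id.sub continuous_const))
      continuous_const)

lemma gradient_hat_eq_zero {m : ℕ} {T : Macro n} {y : E n} (h : hat m T y = 0) :
    gradient (hat m T) y = 0 := gradient_eq_zero_of_nonneg (hat_nonneg m T) h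

lemma stencilFn_hat (K : E n → Matrix (Fin n) (Fin n) ℝ) (m : ℕ) (T : Macro n) (δ x : E n) :
    stencilFn K (hat m T) δ x = ∫ y in overlap (hat m T) δ,
      flux (K (x + y)) (gradient (hat m T) (y - δ)) (gradient (hat m T) y) := by
  unfold stencilFn shift
  simp only [gradient_sub_const]

lemma testFn_eq_hat (hn : n = 2 ∨ n = 3) {Ω : Set (E n)} {Th : Set (Macro n)}
    (h : IsMacroMesh Ω Th) {m : ℕ} {T : Macro n} (hT : T ∈ Th) {z : E n}
    (hz : z ∈ latticeInterior m T) : testFn Th m z = hat m T := by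
  ext y
  rw [testFn, vertexFn_eq_hat_of_latticeInterior hn h hT hz, add_sub_cancel_right]

lemma add_mem_interior_of_mem_overlap (hn : n = 2 ∨ n = 3) {m : ℕ} {T : Macro n} {x δ y : E n}
    (hx : x ∈ latticeInterior m T ∨ x + δ ∈ latticeInterior m T)
    (hy : y ∈ overlap (hat m T) δ) : x + y ∈ T.interior := by
  rw [mem_overlap_hat] at hy
  rcases hx with hx | hx
  · exact mem_interior_of_hat_ne_zero hn hx (by simpa using hy.1)
  · exact mem_interior_of_hat_ne_zero hn hx (by simpa [add_sub_add_left_eq_sub] using hy.2)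

lemma trueMatrix_eq_zero (hn : n = 2 ∨ n = 3) {Ω : Set (E n)} {Th : Set (Macro n)}
    (h : IsMacroMesh Ω Th) {m : ℕ} {T : Macro n} (hT : T ∈ Th)
    (K : E n → Matrix (Fin n) (Fin n) ℝ) {i j : vertices Th m}
    (hij : i.1 ∈ latticeInterior m T ∨ j.1 ∈ latticeInterior m T)
    (hN : ¬ IsNeighbor m T (j.1 - i.1)) : trueMatrix Ω Th m K i j = 0 := by
  unfold trueMatrix bilinForm
  refine integral_eq_zero_of_ae (Filter.Eventually.of_forall fun x => ?_)
  by_cases h1 : vertexFn (fineMesh Th m) i x = 0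
  · change flux _ _ _ = 0
    rw [gradient_eq_zero_of_nonneg (f := vertexFn (fineMesh Th m) i) (vertexFn_nonneg _ _) h1,
      flux_zero_right]
  by_cases h2 : vertexFn (fineMesh Th m) j x = 0
  · change flux _ _ _ = 0
    rw [gradient_eq_zero_of_nonneg (f := vertexFn (fineMesh Th m) j) (vertexFn_nonneg _ _) h2,
      flux_zero_left]
  exfalso
  rcases hij with hi | hj
  · exact hN (isNeighbor_of_overlap hn h hT hi ⟨x, h1, h2⟩).2
  · refine hN ?_
    simpa using (isNeighbor_of_overlap hn h hT hj ⟨x, h2, h1⟩).2.neg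

/-- Since one of the two points is interior, the common support lies in T, where both vertex
functions are translated hats, even if the other point is on the boundary. Moving x_i to the origin
turns the integral into the stencil function. -/
lemma trueMatrix_eq_stencilFn (hn : n = 2 ∨ n = 3) {Ω : Set (E n)} {Th : Set (Macro n)}
    (h : IsMacroMesh Ω Th) {m : ℕ} {T : Macro n} (hT : T ∈ Th)
    (K : E n → Matrix (Fin n) (Fin n) ℝ) {i j : vertices Th m}
    (hij : i.1 ∈ latticeInterior m T ∨ j.1 ∈ latticeInterior m T)
    (hi : i.1 ∈ lattice m T) (hj : j.1 ∈ lattice m T) :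
    trueMatrix Ω Th m K i j = stencilFn K (hat m T) (j.1 - i.1) i.1 := by
  have hn0 : n ≠ 0 := by omega
  have hΩ : IsOpen Ω := by rw [← h.regular]; exact _root_.isOpen_interior
  set S : Set (E n) := (fun x => x - i.1) ⁻¹' overlap (hat m T) (j.1 - i.1) with hS
  have hmem : ∀ x, x ∈ S ↔ x - i.1 ∈ overlap (hat m T) (j.1 - i.1) := by
    intro x; rw [hS, mem_preimage]
  clear_value S
  have hSo : IsOpen S := hS ▸
    (isOpen_overlap_hat m T _).preimage (continuous_id.sub continuous_const)
  have hST : S ⊆ T.interior := by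
    intro x hx
    have := add_mem_interior_of_mem_overlap hn (x := i.1) (δ := j.1 - i.1) (y := x - i.1)
      (by rwa [add_sub_cancel]) ((hmem x).1 hx)
    rwa [add_sub_cancel] at this
  set G : E n → ℝ := fun x =>
    flux (K x) (gradient (hat m T) (x - j.1)) (gradient (hat m T) (x - i.1)) with hG
  have hev : ∀ x ∈ T.interior, ∀ z ∈ lattice m T,
      gradient (vertexFn (fineMesh Th m) z) x = gradient (hat m T) (x - z) := by
    intro x hx z hz
    rw [← gradient_sub_const]
    refine gradient_congr ?_
    filter_upwards [(isOpen_interior hn0 T).mem_nhds hx] with y hy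
    exact vertexFn_eq_hat hn h hT hy hz
  unfold trueMatrix bilinForm
  rw [setIntegral_eq_of_subset_of_forall_sdiff_eq_zero hΩ.measurableSet
    (hST.trans (h.interior_subset hn0 hT))]
  · rw [setIntegral_congr_fun (g := G) hSo.measurableSet fun x hx => by
      simp only [hG]; rw [hev x (hST hx) _ hi, hev x (hST hx) _ hj], stencilFn_hat]
    have hmp := (measurePreserving_add_left (volume : Measure (E n)) i.1)
    rw [← hmp.setIntegral_preimage_emb (MeasurableEquiv.addLeft i.1).measurableEmbedding]
    have e : (fun x => i.1 + x) ⁻¹' S = overlap (hat m T) (j.1 - i.1) := by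
      ext y; rw [mem_preimage, hmem, add_sub_cancel_left]
    rw [e]
    refine integral_congr_ae (Filter.Eventually.of_forall fun y => ?_)
    simp only [hG, add_sub_cancel_left]
    rw [show i.1 + y - j.1 = y - (j.1 - i.1) by abel]
  · rintro x ⟨-, hx⟩
    by_cases h1 : vertexFn (fineMesh Th m) i x = 0
    · rw [gradient_eq_zero_of_nonneg (f := vertexFn (fineMesh Th m) i) (vertexFn_nonneg _ _) h1,
        flux_zero_right]
    by_cases h2 : vertexFn (fineMesh Th m) j x = 0
    · rw [gradient_eq_zero_of_nonneg (f := vertexFn (fineMesh Th m) j) (vertexFn_nonneg _ _) h2,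
        flux_zero_left]
    exfalso
    have hxT : x ∈ T.interior := by
      rcases hij with hi | hj
      · rw [vertexFn_eq_hat_of_latticeInterior hn h hT hi] at h1
        exact mem_interior_of_hat_ne_zero hn hi h1
      · rw [vertexFn_eq_hat_of_latticeInterior hn h hT hj] at h2
        exact mem_interior_of_hat_ne_zero hn hj h2
    rw [vertexFn_eq_hat hn h hT hxT hi] at h1
    rw [vertexFn_eq_hat hn h hT hxT hj] at h2
    refine hx ((hmem x).2 (mem_overlap_hat.2 ⟨h1, ?_⟩))
    rwa [sub_sub_sub_cancel_right]

/-- If only x + δ is interior, x may lie on the boundary of T and is reached as a limit: by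
convexity all points strictly between x and an interior lattice point belong to T_δ. -/
lemma mem_stencilDomain (hn : n = 2 ∨ n = 3) {m : ℕ} {T : Macro n} {x δ z : E n}
    (hx : x ∈ latticeInterior m T ∨ x + δ ∈ latticeInterior m T) (hxl : x ∈ lattice m T)
    (hz : z ∈ latticeInterior m T) : x ∈ stencilDomain T (hat m T) δ := by
  have hn0 : n ≠ 0 := by omega
  have hseg : x ∈ closure (openSegment ℝ x z) := by
    rw [closure_openSegment]; exact left_mem_segment ℝ x z
  refine closure_mono ?_ hseg
  rintro p ⟨a, b, ha, hb, hab, rfl⟩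
  constructor
  · rw [mem_interior_iff hn0]
    intro k
    have e : a • x + b • z = x + b • (z - x) := by
      rw [← eq_sub_iff_add_eq] at hab
      rw [hab]; module
    have h1 := mem_closedInterior_iff.1 (lattice_subset_closedInterior m T hxl) k
    have h2 := (mem_interior_iff hn0).1 hz.2 k
    rw [e, lam_add, map_smul, ← lam_sub, smul_eq_mul]
    have : lam T k x + b * (lam T k z - lam T k x) = a * lam T k x + b * lam T k z := by
      rw [← eq_sub_iff_add_eq] at hab
      rw [hab]; ring
    rw [this]
    positivity
  · intro y hy
    have h1 := add_mem_interior_of_mem_overlap hn hx hy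
    have h2 := add_mem_interior_of_mem_overlap hn (Or.inl hz) hy
    have e : a • x + b • z + y = a • (x + y) + b • (z + y) := by
      rw [smul_add, smul_add, add_add_add_comm, ← add_smul, hab, one_smul]
    rw [e]
    exact convex_interior hn0 T h1 h2 ha.le hb.le hab

/-- Passing to the closure only gives x + y in the closed simplex, but the overlap is open, so a
whole neighbourhood of x + y lies there. -/
lemma add_mem_interior_of_mem_stencilDomain (hn : n ≠ 0) {m : ℕ} {T : Macro n} {x δ y : E n}
    (hx : x ∈ stencilDomain T (hat m T) δ) (hy : y ∈ overlap (hat m T) δ) :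
    x + y ∈ T.interior := by
  have hc : ∀ y ∈ overlap (hat m T) δ, x + y ∈ T.closedInterior := by
    intro y hy
    rw [← closure_interior hn]
    exact map_mem_closure (f := fun x => x + y) (continuous_id.add continuous_const) hx
      fun z hz => hz.2 y hy
  rw [← interior_closedInterior hn, mem_interior]
  refine ⟨(fun z => z - x) ⁻¹' overlap (hat m T) δ, fun z hz => ?_,
    (isOpen_overlap_hat m T δ).preimage (continuous_id.sub continuous_const), by simpa using hy⟩
  simpa using hc _ hz

/-- An entry of the error matrix vanishes or is the projection error of a stencil function. -/
lemma trueMatrix_sub_surrogateMatrix (hn : n = 2 ∨ n = 3) {Ω : Set (E n)} {Th : Set (Macro n)}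
    (h : IsMacroMesh Ω Th) {m : ℕ} (K : E n → Matrix (Fin n) (Fin n) ℝ) (c : Macro n → E n)
    (P : ProjectionFamily Th m c) (i j : vertices Th m) :
    (trueMatrix Ω Th m K - surrogateMatrix Ω Th m K c P) i j = 0 ∨
      ∃ T ∈ Th, (i.1 ∈ latticeInterior m T ∨ j.1 ∈ latticeInterior m T) ∧
        i.1 ∈ lattice m T ∧ j.1 ∈ lattice m T ∧ j.1 - i.1 ∈ translations Th m T ∧
        (trueMatrix Ω Th m K - surrogateMatrix Ω Th m K c P) i j =
          stencilFn K (hat m T) (j.1 - i.1) i.1 -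
            surrogateStencilFn Th m K c P T (j.1 - i.1) i.1 := by
  have hn0 : n ≠ 0 := by omega
  by_cases hb : i.1 ∈ boundaryVertices Th m ∧ j.1 ∈ boundaryVertices Th m
  · left; simp [surrogateMatrix, hb]
  have hint : ∀ v : vertices Th m, v.1 ∉ boundaryVertices Th m →
      ∃ T ∈ Th, v.1 ∈ latticeInterior m T := by
    intro v hv
    obtain ⟨T, hT, hvT⟩ := mem_iUnion₂.1 v.2
    refine ⟨T, hT, ?_⟩
    by_contra h'
    exact hv (mem_iUnion₂.2 ⟨T, hT, hvT, h'⟩)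
  have hlat : ∀ T ∈ Th, (i.1 ∈ latticeInterior m T ∨ j.1 ∈ latticeInterior m T) →
      IsNeighbor m T (j.1 - i.1) → i.1 ∈ lattice m T ∧ j.1 ∈ lattice m T := by
    rintro T hT (hi | hj) hN
    · exact ⟨hi.1, by simpa using hN.add_mem_lattice hn0 hi⟩
    · exact ⟨by simpa using hN.neg.add_mem_lattice hn0 hj, hj.1⟩
  by_cases hex : ∃ T ∈ Th, j.1 - i.1 ∈ translations Th m T ∧
      (i.1 ∈ latticeInterior m T ∨ j.1 ∈ latticeInterior m T)
  · right
    -- The element has to be the one selected in `surrogateMatrix`; its defining property suffices,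
    -- without uniqueness.
    obtain ⟨hT, htr, hij⟩ := hex.choose_spec
    have hN := isNeighbor_of_mem_translations hn h hT htr
    obtain ⟨hi, hj⟩ := hlat _ hT hij hN
    refine ⟨hex.choose, hT, hij, hi, hj, htr, ?_⟩
    rw [Matrix.sub_apply, trueMatrix_eq_stencilFn hn h hT K hij hi hj]
    simp only [surrogateMatrix]
    rw [if_neg hb, dif_pos hex]
  · left
    have hT : ∃ T ∈ Th, i.1 ∈ latticeInterior m T ∨ j.1 ∈ latticeInterior m T := by
      rcases not_and_or.1 hb with hb | hb
      · obtain ⟨T, hT, hi⟩ := hint i hb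
        exact ⟨T, hT, Or.inl hi⟩
      · obtain ⟨T, hT, hj⟩ := hint j hb
        exact ⟨T, hT, Or.inr hj⟩
    obtain ⟨T, hT, hij⟩ := hT
    -- The surrogate entry is zero here, and a pair that is not adjacent has zero true entry as
    -- well.
    have hN : ¬ IsNeighbor m T (j.1 - i.1) := by
      intro hN
      refine hex ⟨T, hT, ?_, hij⟩
      rcases hij with hi | hj
      · exact mem_translations_of_isNeighbor hn h hT hN hi
      · exact mem_translations_of_isNeighbor hn h hT hN hj
    rw [Matrix.sub_apply, trueMatrix_eq_zero hn h hT K hij hN]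
    simp only [surrogateMatrix]
    rw [if_neg hb, dif_neg hex, sub_zero]

/-! ### Weak derivatives -/

lemma integrableOn_mul_of_tsupport_subset {U : Set (E n)} (hU : MeasurableSet U)
    {g η : E n → ℝ} (hg : LocallyIntegrableOn g U volume) (hη : Continuous η)
    (hc : HasCompactSupport η) (hs : tsupport η ⊆ U) :
    IntegrableOn (fun x => g x * η x) U volume := by
  have h1 : IntegrableOn (fun x => g x * η x) (tsupport η) volume :=
    (hg.integrableOn_compact_subset hs hc).mul_continuousOn hη.continuousOn hc
  refine h1.of_forall_sdiff_eq_zero hU fun x hx => ?_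
  rw [image_eq_zero_of_notMem_tsupport hx.2, mul_zero]

lemma IsWeakDeriv.ae_eq {U : Set (E n)} (hU : IsOpen U) {k : ℕ} {s : Fin k → Fin n}
    {v g g' : E n → ℝ} (h : IsWeakDeriv U s v g) (h' : IsWeakDeriv U s v g') :
    ∀ᵐ x ∂(volume.restrict U), g x = g' x := by
  rw [ae_restrict_iff' hU.measurableSet]
  have := hU.ae_eq_zero_of_integral_contDiff_smul_eq_zero (f := fun x => g x - g' x)
    (μ := volume) (h.2.1.sub h'.2.1) ?_
  · filter_upwards [this] with x hx hxU
    exact sub_eq_zero.1 (hx hxU)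
  intro η hη hc hs
  have e1 := h.2.2 η hη hc hs
  have e2 := h'.2.2 η hη hc hs
  have e3 : ∫ x in U, g x * η x = ∫ x in U, g' x * η x := by
    rw [e1] at e2
    exact mul_left_cancel₀ (by positivity) e2
  rw [← setIntegral_eq_integral_of_forall_compl_eq_zero (s := U)]
  · have i1 := integrableOn_mul_of_tsupport_subset hU.measurableSet h.2.1 hη.continuous hc hs
    have i2 := integrableOn_mul_of_tsupport_subset hU.measurableSet h'.2.1 hη.continuous hc hs
    rw [← sub_eq_zero, ← integral_sub i1 i2] at e3
    rw [← e3]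
    congr 1
    ext x
    simp only [smul_eq_mul]
    ring
  · intro x hx
    rw [image_eq_zero_of_notMem_tsupport fun hx' => hx (hs hx'), zero_smul]

lemma MemSobolev.isWeakDeriv {U : Set (E n)} {k j : ℕ} {v : E n → ℝ}
    (h : MemSobolev k U v) (hj : j ≤ k) (s : Fin j → Fin n) :
    IsWeakDeriv U s v (weakDeriv U s v) := by
  obtain ⟨g, hg, -⟩ := h.2 j hj s
  have hex : ∃ g, IsWeakDeriv U s v g := ⟨g, hg⟩
  rw [weakDeriv, dif_pos hex]
  exact hex.choose_spec

/-- `weakDeriv` is an arbitrary choice; almost everywhere uniqueness transfers the bound from the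
representative supplied by `MemSobolev`. -/
lemma MemSobolev.memLp_weakDeriv {U : Set (E n)} (hU : IsOpen U) {k j : ℕ} {v : E n → ℝ}
    (h : MemSobolev k U v) (hj : j ≤ k) (s : Fin j → Fin n) :
    MemLp (weakDeriv U s v) ⊤ (volume.restrict U) := by
  obtain ⟨g, hg, hm⟩ := h.2 j hj s
  exact hm.ae_eq (hg.ae_eq hU (h.isWeakDeriv hj s))

lemma sobolevSeminorm_nonneg (k : ℕ) (U : Set (E n)) (v : E n → ℝ) :
    0 ≤ sobolevSeminorm k U v := Real.iSup_nonneg fun _ => ENNReal.toReal_nonneg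

lemma MemSobolev.ae_abs_weakDeriv_le {U : Set (E n)} (hU : IsOpen U) {k : ℕ} {v : E n → ℝ}
    (h : MemSobolev k U v) (s : Fin k → Fin n) :
    ∀ᵐ x ∂(volume.restrict U), |weakDeriv U s v x| ≤ sobolevSeminorm k U v := by
  have hm := h.memLp_weakDeriv hU le_rfl s
  have h1 : (eLpNorm (weakDeriv U s v) ⊤ (volume.restrict U)).toReal ≤ sobolevSeminorm k U v :=
    le_ciSup (f := fun s => (eLpNorm (weakDeriv U s v) ⊤ (volume.restrict U)).toReal)
      (finite_range _).bddAbove s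
  filter_upwards [ae_le_eLpNormEssSup (f := weakDeriv U s v) (μ := volume.restrict U)] with x hx
  refine le_trans ?_ h1
  rw [eLpNorm_exponent_top]
  have hfin : eLpNormEssSup (weakDeriv U s v) (volume.restrict U) ≠ ⊤ := by
    have := hm.2.ne
    rwa [eLpNorm_exponent_top] at this
  rw [← Real.norm_eq_abs, ← toReal_enorm]
  exact ENNReal.toReal_mono hfin hx

/-! ### Smoothing by integration against a test function -/

/-- The convolution of `w` with `θ`. -/
def smoothing (w θ : E n → ℝ) (x : E n) : ℝ := ∫ y, w y * θ (x - y)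

lemma hasDerivAt_smoothing {w θ : E n → ℝ} (hw : LocallyIntegrable w volume)
    (hθ : ContDiff ℝ ∞ θ) (hc : HasCompactSupport θ) (x d : E n) (t : ℝ) :
    HasDerivAt (fun t : ℝ => smoothing w θ (x + t • d))
      (smoothing w (fun z => fderiv ℝ θ z d) (x + t • d)) t := by
  have h1 := hc.hasFDerivAt_convolution_right (ContinuousLinearMap.lsmul ℝ ℝ) hw
    (hθ.of_le (by simp)) (x + t • d)
  have h2 : HasDerivAt (fun t : ℝ => x + t • d) d t := by
    simpa using ((hasDerivAt_id t).smul_const d).const_add x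
  have h3 := h1.comp_hasDerivAt t h2
  rw [convolution_precompR_apply _ hw (hc.fderiv ℝ) (hθ.continuous_fderiv (by simp))] at h3
  exact h3

/-- The iterated directional derivative. -/
def dirDeriv (k : ℕ) (d : E n) (θ : E n → ℝ) (z : E n) : ℝ :=
  iteratedFDeriv ℝ k θ z (fun _ => d)

lemma contDiff_dirDeriv (k : ℕ) (d : E n) {θ : E n → ℝ} (hθ : ContDiff ℝ ∞ θ) :
    ContDiff ℝ ∞ (dirDeriv k d θ) := by
  have h : ContDiff ℝ ∞ (iteratedFDeriv ℝ k θ) :=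
    hθ.iteratedFDeriv_right (m := ∞) (by exact_mod_cast le_top)
  exact (ContinuousMultilinearMap.apply ℝ (fun _ : Fin k => E n) ℝ (fun _ => d)).contDiff.comp h

lemma hasCompactSupport_dirDeriv (k : ℕ) (d : E n) {θ : E n → ℝ} (hc : HasCompactSupport θ) :
    HasCompactSupport (dirDeriv k d θ) :=
  (hc.iteratedFDeriv (𝕜 := ℝ) k).comp_left
    (g := fun f : ContinuousMultilinearMap ℝ (fun _ : Fin k => E n) ℝ => f fun _ => d) (by simp)

lemma fderiv_dirDeriv (k : ℕ) (d : E n) {θ : E n → ℝ} (hθ : ContDiff ℝ ∞ θ) :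
    (fun z => fderiv ℝ (dirDeriv k d θ) z d) = dirDeriv (k + 1) d θ := by
  ext z
  have h : ContDiff ℝ ∞ (iteratedFDeriv ℝ k θ) :=
    hθ.iteratedFDeriv_right (m := ∞) (by exact_mod_cast le_top)
  have h1 : DifferentiableAt ℝ (iteratedFDeriv ℝ k θ) z := (h.differentiable (by simp)) z
  have h2 := ((ContinuousMultilinearMap.apply ℝ (fun _ : Fin k => E n) ℝ
    (fun _ => d)).hasFDerivAt.comp z h1.hasFDerivAt).fderiv
  have e : dirDeriv k d θ = (ContinuousMultilinearMap.apply ℝ (fun _ : Fin k => E n) ℝ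
    (fun _ => d)) ∘ iteratedFDeriv ℝ k θ := rfl
  rw [e, h2, dirDeriv, iteratedFDeriv_succ_apply_left]
  rfl

lemma iteratedDeriv_smoothing {w θ : E n → ℝ} (hw : LocallyIntegrable w volume)
    (hθ : ContDiff ℝ ∞ θ) (hc : HasCompactSupport θ) (x d : E n) (k : ℕ) :
    iteratedDeriv k (fun t : ℝ => smoothing w θ (x + t • d)) =
      fun t : ℝ => smoothing w (dirDeriv k d θ) (x + t • d) := by
  induction k with
  | zero =>
    rw [iteratedDeriv_zero]
    have : dirDeriv 0 d θ = θ := by ext z; simp [dirDeriv]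
    rw [this]
  | succ k ih =>
    rw [iteratedDeriv_succ, ih]
    ext t
    rw [(hasDerivAt_smoothing hw (contDiff_dirDeriv k d hθ) (hasCompactSupport_dirDeriv k d hc)
      x d t).deriv, fderiv_dirDeriv k d hθ]

lemma contDiff_smoothing {w θ : E n → ℝ} (hw : LocallyIntegrable w volume)
    (hθ : ContDiff ℝ ∞ θ) (hc : HasCompactSupport θ) (x d : E n) :
    ContDiff ℝ ∞ (fun t : ℝ => smoothing w θ (x + t • d)) := by
  have h1 : ContDiff ℝ ∞ (smoothing w θ) :=
    hc.contDiff_convolution_right (ContinuousLinearMap.lsmul ℝ ℝ) hw hθ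
  exact h1.comp (contDiff_const.add (contDiff_id.smul contDiff_const))

lemma dirDeriv_eq_sum (k : ℕ) (d : E n) (θ : E n → ℝ) (z : E n) :
    dirDeriv k d θ z = ∑ s : Fin k → Fin n, (∏ l, d (s l)) * partialDeriv s θ z := by
  have hd : d = ∑ a, d a • EuclideanSpace.single a (1 : ℝ) := by
    ext b
    simp [Finset.sum_apply, Pi.single_apply]
  unfold dirDeriv partialDeriv
  conv_lhs => rw [hd]
  rw [ContinuousMultilinearMap.map_sum]
  refine Finset.sum_congr rfl fun s _ => ?_
  rw [ContinuousMultilinearMap.map_smul_univ, smul_eq_mul]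

lemma partialDeriv_reflect {k : ℕ} (s : Fin k → Fin n) {θ : E n → ℝ} (hθ : ContDiff ℝ ∞ θ)
    (x y : E n) : partialDeriv s (fun y => θ (x - y)) y = (-1) ^ k * partialDeriv s θ (x - y) := by
  have e : (fun y => θ (x - y)) =
      fun y => (θ ∘ (-ContinuousLinearMap.id ℝ (E n))) (y - x) := by
    ext y; simp
  unfold partialDeriv
  rw [e, iteratedFDeriv_comp_sub, ContinuousLinearMap.iteratedFDeriv_comp_right _ hθ _
    (by exact_mod_cast le_top), ContinuousMultilinearMap.compContinuousLinearMap_apply]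
  have h1 : (fun l => (-ContinuousLinearMap.id ℝ (E n)) (EuclideanSpace.single (s l) (1 : ℝ))) =
      fun l => (-1 : ℝ) • EuclideanSpace.single (s l) (1 : ℝ) := by
    ext l; simp
  rw [h1, ContinuousMultilinearMap.map_smul_univ]
  simp

lemma integral_indicator_mul {U : Set (E n)} (hU : MeasurableSet U) (f g : E n → ℝ) :
    ∫ y, U.indicator f y * g y = ∫ y in U, f y * g y := by
  rw [← integral_indicator hU]
  congr 1
  ext y
  by_cases hy : y ∈ U <;> simp [hy]

/-- Test the weak derivative with y ↦ θ(x - y), whose support stays in U. The sign (-1)^k from the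
reflection cancels that of the integration by parts. -/
lemma smoothing_partialDeriv {U : Set (E n)} (hU : IsOpen U) {k : ℕ} {s : Fin k → Fin n}
    {v g θ : E n → ℝ} (h : IsWeakDeriv U s v g) (hθ : ContDiff ℝ ∞ θ) {ε : ℝ}
    (hc : tsupport θ ⊆ Metric.closedBall 0 ε) {x : E n} (hx : Metric.closedBall x ε ⊆ U) :
    smoothing (U.indicator v) (partialDeriv s θ) x = smoothing (U.indicator g) θ x := by
  have hη : ContDiff ℝ ∞ (fun y => θ (x - y)) := hθ.comp (contDiff_const.sub contDiff_id)
  have hsupp : tsupport (fun y => θ (x - y)) ⊆ Metric.closedBall x ε := by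
    refine closure_minimal (fun y hy => ?_) Metric.isClosed_closedBall
    have := hc (subset_tsupport θ hy)
    rw [mem_closedBall_zero_iff] at this
    rwa [Metric.mem_closedBall, dist_comm, dist_eq_norm]
  have hcs : HasCompactSupport (fun y => θ (x - y)) :=
    (isCompact_closedBall x ε).of_isClosed_subset (isClosed_tsupport _) hsupp
  have h1 := h.2.2 _ hη hcs (hsupp.trans hx)
  unfold smoothing
  rw [integral_indicator_mul hU.measurableSet, integral_indicator_mul hU.measurableSet]
  simp only [partialDeriv_reflect s hθ] at h1
  have h2 : ∫ y in U, v y * ((-1) ^ k * partialDeriv s θ (x - y)) =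
      (-1) ^ k * ∫ y in U, v y * partialDeriv s θ (x - y) := by
    rw [← integral_const_mul]
    congr 1
    ext y
    ring
  rw [h2] at h1
  exact mul_left_cancel₀ (by positivity) h1

lemma smoothing_sum {ι : Type*} (t : Finset ι) {w : E n → ℝ} (hw : LocallyIntegrable w volume)
    (a : ι → ℝ) (θ : ι → E n → ℝ) (hθ : ∀ i, Continuous (θ i))
    (hc : ∀ i, HasCompactSupport (θ i)) (x : E n) :
    smoothing w (fun z => ∑ i ∈ t, a i * θ i z) x = ∑ i ∈ t, a i * smoothing w (θ i) x := by
  unfold smoothing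
  simp only [Finset.mul_sum]
  rw [integral_finsetSum]
  · refine Finset.sum_congr rfl fun i _ => ?_
    rw [← integral_const_mul]
    congr 1
    ext y
    ring
  · intro i _
    have h1 : Integrable (fun y => w y * θ i (x - y)) volume := by
      have := (hc i).convolutionExists_right (ContinuousLinearMap.lsmul ℝ ℝ) hw (hθ i) x
      exact this
    convert h1.const_mul (a i) using 1
    ext y
    ring

lemma contDiff_partialDeriv {k : ℕ} (s : Fin k → Fin n) {θ : E n → ℝ} (hθ : ContDiff ℝ ∞ θ) :
    ContDiff ℝ ∞ (partialDeriv s θ) := by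
  have h : ContDiff ℝ ∞ (iteratedFDeriv ℝ k θ) :=
    hθ.iteratedFDeriv_right (m := ∞) (by exact_mod_cast le_top)
  exact (ContinuousMultilinearMap.apply ℝ (fun _ : Fin k => E n) ℝ _).contDiff.comp h

lemma hasCompactSupport_partialDeriv {k : ℕ} (s : Fin k → Fin n) {θ : E n → ℝ}
    (hc : HasCompactSupport θ) : HasCompactSupport (partialDeriv s θ) :=
  (hc.iteratedFDeriv (𝕜 := ℝ) k).comp_left
    (g := fun f : ContinuousMultilinearMap ℝ (fun _ : Fin k => E n) ℝ =>
      f fun l => EuclideanSpace.single (s l) (1 : ℝ)) (by simp)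

lemma abs_smoothing_le {U : Set (E n)} (hU : MeasurableSet U) {g θ : E n → ℝ} {G : ℝ}
    (hG : 0 ≤ G) (hg : ∀ᵐ x ∂(volume.restrict U), |g x| ≤ G) (hθ : ∀ x, 0 ≤ θ x)
    (hi : Integrable θ volume) (h1 : ∫ x, θ x = 1) (x : E n) :
    |smoothing (U.indicator g) θ x| ≤ G := by
  have hi' : Integrable (fun y => θ (x - y)) volume := hi.comp_sub_left x
  have : ∫ y, G * θ (x - y) = G := by
    rw [integral_const_mul, integral_sub_left_eq_self, h1, mul_one]
  unfold smoothing
  rw [← Real.norm_eq_abs]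
  conv_rhs => rw [← this]
  refine norm_integral_le_of_norm_le (hi'.const_mul G) ?_
  rw [ae_restrict_iff' hU] at hg
  filter_upwards [hg] with y hy
  rw [norm_mul, Real.norm_of_nonneg (hθ _)]
  refine mul_le_mul_of_nonneg_right ?_ (hθ _)
  by_cases hyU : y ∈ U
  · rw [indicator_of_mem hyU]; exact hy hyU
  · rw [indicator_of_notMem hyU, norm_zero]; exact hG

/-! ### Polynomial approximation in Sobolev spaces -/

lemma smoothing_dirDeriv {U : Set (E n)} (hU : IsOpen U) {r k : ℕ} {v θ : E n → ℝ}
    (h : MemSobolev r U v) (hw : LocallyIntegrable (U.indicator v) volume) (hk : k ≤ r)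
    (hθ : ContDiff ℝ ∞ θ) {ε : ℝ} (hc : tsupport θ ⊆ Metric.closedBall 0 ε) (d : E n) {x : E n}
    (hx : Metric.closedBall x ε ⊆ U) :
    smoothing (U.indicator v) (dirDeriv k d θ) x = ∑ s : Fin k → Fin n,
      (∏ l, d (s l)) * smoothing (U.indicator (weakDeriv U s v)) θ x := by
  have hcs : HasCompactSupport θ :=
    (isCompact_closedBall 0 ε).of_isClosed_subset (isClosed_tsupport _) hc
  have e : dirDeriv k d θ = fun z => ∑ s : Fin k → Fin n, (∏ l, d (s l)) * partialDeriv s θ z :=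
    funext (dirDeriv_eq_sum k d θ)
  rw [e, smoothing_sum _ hw _ (fun s => partialDeriv s θ)
    (fun s => (contDiff_partialDeriv s hθ).continuous)
    (fun s => hasCompactSupport_partialDeriv s hcs)]
  refine Finset.sum_congr rfl fun s _ => ?_
  rw [smoothing_partialDeriv hU (h.isWeakDeriv hk s) hθ hc hx]

lemma abs_prod_coord_le {k : ℕ} (s : Fin k → Fin n) {d : E n} {H : ℝ} (hd : ‖d‖ ≤ H) :
    |∏ l, d (s l)| ≤ H ^ k := by
  rw [Finset.abs_prod]
  calc ∏ l, |d (s l)| ≤ ∏ _l : Fin k, H :=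
        Finset.prod_le_prod (fun _ _ => abs_nonneg _)
          fun l _ => (PiLp.norm_apply_le d (s l)).trans hd
    _ = H ^ k := by simp

/-- One-dimensional Taylor formula with Lagrange remainder along the segment. The factor n^(r+1)
counts the index sequences in the remainder, and its factorial is discarded. The ball condition
keeps the mollifier inside U on the whole segment. -/
lemma taylor_smoothing {U : Set (E n)} (hU : IsOpen U) {r : ℕ} {v θ : E n → ℝ}
    (h : MemSobolev (r + 1) U v) (hw : LocallyIntegrable (U.indicator v) volume)
    (hθ : ContDiff ℝ ∞ θ) (hθ0 : ∀ x, 0 ≤ θ x) (hθ1 : ∫ x, θ x = 1) {ε : ℝ}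
    (hc : tsupport θ ⊆ Metric.closedBall 0 ε) {x d : E n} {H : ℝ} (hd : ‖d‖ ≤ H)
    (hx : ∀ t ∈ Icc (0 : ℝ) 1, Metric.closedBall (x + t • d) ε ⊆ U) :
    |smoothing (U.indicator v) θ (x + d) - ∑ k ∈ Finset.range (r + 1),
      ((k.factorial : ℝ)⁻¹ * ∑ s : Fin k → Fin n,
        (∏ l, d (s l)) * smoothing (U.indicator (weakDeriv U s v)) θ x)| ≤
      n ^ (r + 1) * H ^ (r + 1) * sobolevSeminorm (r + 1) U v := by
  have hcs : HasCompactSupport θ :=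
    (isCompact_closedBall 0 ε).of_isClosed_subset (isClosed_tsupport _) hc
  have hint : Integrable θ volume := hθ.continuous.integrable_of_hasCompactSupport hcs
  have hH : 0 ≤ H := (norm_nonneg d).trans hd
  set F : ℝ → ℝ := fun t => smoothing (U.indicator v) θ (x + t • d) with hF
  have hFs : ContDiff ℝ ∞ F := contDiff_smoothing hw hθ hcs x d
  obtain ⟨t, ht, e⟩ := taylor_mean_remainder_lagrange_iteratedDeriv (n := r) (zero_ne_one (α := ℝ))
    (hFs.of_le (by exact_mod_cast le_top)).contDiffOn
  rw [uIoo_of_le zero_le_one] at ht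
  have hder : ∀ k ≤ r + 1, ∀ t ∈ Icc (0 : ℝ) 1, iteratedDeriv k F t = ∑ s : Fin k → Fin n,
      (∏ l, d (s l)) * smoothing (U.indicator (weakDeriv U s v)) θ (x + t • d) := by
    intro k hk t ht
    rw [hF, iteratedDeriv_smoothing hw hθ hcs]
    exact smoothing_dirDeriv hU h hw hk hθ hc d (hx t ht)
  have e1 : taylorWithinEval F r (uIcc 0 1) 0 1 = ∑ k ∈ Finset.range (r + 1),
      ((k.factorial : ℝ)⁻¹ * ∑ s : Fin k → Fin n,
        (∏ l, d (s l)) * smoothing (U.indicator (weakDeriv U s v)) θ x) := by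
    rw [taylor_within_apply]
    refine Finset.sum_congr rfl fun k hk => ?_
    rw [iteratedDerivWithin_eq_iteratedDeriv (uniqueDiffOn_uIcc zero_ne_one)
      (hFs.contDiffAt.of_le (by exact_mod_cast le_top)) (by simp),
      hder k (Finset.mem_range.1 hk).le 0 (by simp)]
    simp
  have e2 : F 1 = smoothing (U.indicator v) θ (x + d) := by simp [hF]
  rw [e1, e2] at e
  rw [e, sub_zero, one_pow, mul_one, hder _ le_rfl t ⟨ht.1.le, ht.2.le⟩, abs_div]
  have hG := sobolevSeminorm_nonneg (r + 1) U v
  have hb : |∑ s : Fin (r + 1) → Fin n, (∏ l, d (s l)) *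
      smoothing (U.indicator (weakDeriv U s v)) θ (x + t • d)| ≤
      n ^ (r + 1) * H ^ (r + 1) * sobolevSeminorm (r + 1) U v := by
    calc _ ≤ ∑ s : Fin (r + 1) → Fin n, |(∏ l, d (s l)) *
          smoothing (U.indicator (weakDeriv U s v)) θ (x + t • d)| :=
          Finset.abs_sum_le_sum_abs _ _
      _ ≤ ∑ _s : Fin (r + 1) → Fin n, H ^ (r + 1) * sobolevSeminorm (r + 1) U v := by
          refine Finset.sum_le_sum fun s _ => ?_
          rw [abs_mul]
          exact mul_le_mul (abs_prod_coord_le s hd)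
            (abs_smoothing_le hU.measurableSet hG (h.ae_abs_weakDeriv_le hU s) hθ0 hint hθ1 _)
            (abs_nonneg _) (by positivity)
      _ = _ := by simp; ring
  refine (div_le_self (abs_nonneg _) ?_).trans hb
  rw [Nat.abs_cast]
  exact_mod_cast Nat.one_le_iff_ne_zero.2 (Nat.factorial_ne_zero _)

/-- A sequence of mollifiers. -/
def bump (n i : ℕ) : ContDiffBump (0 : E n) where
  rIn := 1 / (i + 1) / 2
  rOut := 1 / (i + 1)
  rIn_pos := by positivity
  rIn_lt_rOut := half_lt_self (by positivity)

lemma tsupport_bump_normed (n i : ℕ) : tsupport ((bump n i).normed volume) ⊆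
    Metric.closedBall 0 (1 / (i + 1)) := by
  rw [ContDiffBump.tsupport_normed_eq]
  exact subset_rfl

lemma ae_tendsto_smoothing {w : E n → ℝ} (hw : LocallyIntegrable w volume) :
    ∀ᵐ x, Filter.Tendsto (fun i => smoothing w ((bump n i).normed volume) x) Filter.atTop
      (nhds (w x)) := by
  have h1 : Filter.Tendsto (fun i => (bump n i).rOut) Filter.atTop (nhds 0) :=
    tendsto_one_div_add_atTop_nhds_zero_nat
  -- A bounded ratio of outer to inner radius is what almost everywhere convergence asks of the
  -- mollifiers.
  have h2 : ∀ᶠ i in Filter.atTop, (bump n i).rOut ≤ 2 * (bump n i).rIn :=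
    Filter.Eventually.of_forall fun i => le_of_eq (by simp only [bump]; ring)
  filter_upwards [ContDiffBump.ae_convolution_tendsto_right_of_locallyIntegrable h1 h2 hw]
    with x hx
  refine hx.congr fun i => ?_
  rw [convolution_lsmul_swap]
  unfold smoothing
  congr 1
  ext y
  rw [smul_eq_mul, mul_comm]

lemma locallyIntegrable_indicator {U : Set (E n)} (hU : MeasurableSet U)
    (hb : Bornology.IsBounded U) {v : E n → ℝ} (hv : MemLp v ⊤ (volume.restrict U)) :
    LocallyIntegrable (U.indicator v) volume := by
  have : IsFiniteMeasure (volume.restrict U) := ⟨by simpa using hb.measure_lt_top⟩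
  have h1 : IntegrableOn v U volume := hv.integrable le_top
  exact ((integrable_indicator_iff hU).2 h1).locallyIntegrable

/-- A function in `W^{r+1,∞}` of a bounded convex open set is approximated by a polynomial of
degree at most `r`. -/
lemma MemSobolev.exists_polynomial_approx {U : Set (E n)} (hU : IsOpen U) (hconv : Convex ℝ U)
    (hne : U.Nonempty) (hb : Bornology.IsBounded U) {r : ℕ} {v : E n → ℝ}
    (h : MemSobolev (r + 1) U v) :
    ∃ (x₀ : E n) (a : ∀ k : ℕ, (Fin k → Fin n) → ℝ), ∀ᵐ x ∂(volume.restrict U),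
      |v x - ∑ k ∈ Finset.range (r + 1), ∑ s : Fin k → Fin n,
        a k s * ∏ l, (x (s l) - x₀ (s l))| ≤
      n ^ (r + 1) * Metric.diam U ^ (r + 1) * sobolevSeminorm (r + 1) U v := by
  have hw := locallyIntegrable_indicator hU.measurableSet hb h.1
  have hae : ∀ᵐ x : E n, ∀ k : ℕ, ∀ s : Fin k → Fin n, k ≤ r →
      Filter.Tendsto (fun i => smoothing (U.indicator (weakDeriv U s v))
        ((bump n i).normed volume) x) Filter.atTop (nhds (U.indicator (weakDeriv U s v) x)) := by
    rw [ae_all_iff]; intro k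
    rw [ae_all_iff]; intro s
    by_cases hk : k ≤ r
    · filter_upwards [ae_tendsto_smoothing (locallyIntegrable_indicator hU.measurableSet hb
        (h.memLp_weakDeriv hU (hk.trans (Nat.le_succ r)) s))] with x hx _
      exact hx
    · exact Filter.Eventually.of_forall fun x hk' => absurd hk' hk
  -- Almost every point is one at which the mollified weak derivatives of all orders up to r
  -- converge, so U contains such a point; it serves as expansion point.
  obtain ⟨x₀, hx₀, hx₀U⟩ := (Measure.dense_of_ae hae).exists_mem_open hU hne
  refine ⟨x₀, fun k s => (k.factorial : ℝ)⁻¹ * U.indicator (weakDeriv U s v) x₀, ?_⟩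
  rw [ae_restrict_iff' hU.measurableSet]
  filter_upwards [ae_tendsto_smoothing hw] with x hx hxU
  rw [indicator_of_mem hxU] at hx
  have hseg : segment ℝ x₀ x ⊆ U := hconv.segment_subset hx₀U hxU
  have hcomp : IsCompact (segment ℝ x₀ x) := by
    rw [segment_eq_image_lineMap]
    exact isCompact_Icc.image AffineMap.lineMap_continuous
  -- Mollifiers of radius below δ see only U from every point of the segment.
  obtain ⟨δ, hδ, hδU⟩ := hcomp.exists_cthickening_subset_open hU hseg
  have hlim : Filter.Tendsto (fun i => smoothing (U.indicator v) ((bump n i).normed volume) x -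
      ∑ k ∈ Finset.range (r + 1), ((k.factorial : ℝ)⁻¹ * ∑ s : Fin k → Fin n,
        (∏ l, (x - x₀) (s l)) * smoothing (U.indicator (weakDeriv U s v))
          ((bump n i).normed volume) x₀)) Filter.atTop (nhds (v x -
      ∑ k ∈ Finset.range (r + 1), ((k.factorial : ℝ)⁻¹ * ∑ s : Fin k → Fin n,
        (∏ l, (x - x₀) (s l)) * U.indicator (weakDeriv U s v) x₀))) := by
    refine hx.sub (tendsto_finsetSum _ fun k hk => ?_)
    refine Filter.Tendsto.const_mul _ (tendsto_finsetSum _ fun s _ => ?_)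
    exact (hx₀ k s (Nat.lt_succ_iff.1 (Finset.mem_range.1 hk))).const_mul _
  have hfin : |v x - ∑ k ∈ Finset.range (r + 1), ((k.factorial : ℝ)⁻¹ * ∑ s : Fin k → Fin n,
        (∏ l, (x - x₀) (s l)) * U.indicator (weakDeriv U s v) x₀)| ≤
      n ^ (r + 1) * Metric.diam U ^ (r + 1) * sobolevSeminorm (r + 1) U v := by
    refine le_of_tendsto hlim.abs ?_
    have hsmall : ∀ᶠ i : ℕ in Filter.atTop, 1 / ((i : ℝ) + 1) < δ :=
      tendsto_one_div_add_atTop_nhds_zero_nat.eventually_lt_const hδ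
    filter_upwards [hsmall] with i hi
    have := taylor_smoothing hU h hw (bump n i).contDiff_normed
      (fun y => (bump n i).nonneg_normed y) ((bump n i).integral_normed)
      (tsupport_bump_normed n i) (x := x₀) (d := x - x₀) (H := Metric.diam U)
      (by rw [← dist_eq_norm]; exact Metric.dist_le_diam_of_mem hb hxU hx₀U) ?_
    · rwa [add_sub_cancel] at this
    · intro t ht
      refine Subset.trans (Subset.trans ?_ (Metric.cthickening_mono hi.le _)) hδU
      refine Metric.closedBall_subset_cthickening ?_ _
      rw [segment_eq_image']
      exact ⟨t, ht, rfl⟩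
  refine le_of_eq_of_le (congrArg abs (congrArg (v x - ·) ?_)) hfin
  refine Finset.sum_congr rfl fun k _ => ?_
  rw [Finset.mul_sum]
  refine Finset.sum_congr rfl fun s _ => ?_
  simp only [PiLp.sub_apply]
  ring

/-! ### Correlation integrals -/

/-- The correlation integral of `k` with the weight `W`. -/
def corr (k W : E n → ℝ) (x : E n) : ℝ := ∫ y, k (x + y) * W y

lemma integrable_corr {k W : E n → ℝ} {M : ℝ} (hk : AEStronglyMeasurable k volume)
    (hM : ∀ᵐ x, |k x| ≤ M) (hW : Integrable W volume) (x : E n) :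
    Integrable (fun y => k (x + y) * W y) volume := by
  have hmp := measurePreserving_add_left (volume : Measure (E n)) x
  refine hW.bdd_mul (c := M) (hk.comp_measurePreserving hmp) ?_
  filter_upwards [hmp.quasiMeasurePreserving.ae hM] with y hy
  exact hy

lemma abs_corr_le {k W : E n → ℝ} {M : ℝ} (hM : ∀ᵐ x, |k x| ≤ M) (hW : Integrable W volume)
    (x : E n) : |corr k W x| ≤ M * ∫ y, |W y| := by
  have hmp := measurePreserving_add_left (volume : Measure (E n)) x
  rw [← integral_const_mul, ← Real.norm_eq_abs]
  refine norm_integral_le_of_norm_le (hW.norm.const_mul M) ?_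
  filter_upwards [hmp.quasiMeasurePreserving.ae hM] with y hy
  rw [norm_mul, Real.norm_eq_abs]
  exact mul_le_mul_of_nonneg_right hy (abs_nonneg _)

lemma continuous_corr_of_hasCompactSupport {k W : E n → ℝ} (hk : LocallyIntegrable k volume)
    (hW : Continuous W) (hc : HasCompactSupport W) : Continuous (corr k W) := by
  have h1 : Continuous (smoothing k fun y => W (-y)) :=
    (hc.comp_homeomorph (Homeomorph.neg (E n))).continuous_convolution_right
      (ContinuousLinearMap.lsmul ℝ ℝ) hk (hW.comp continuous_neg)
  convert h1 using 1
  ext x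
  unfold corr smoothing
  rw [← integral_add_left_eq_self (fun y => k y * W (-(x - y))) x]
  congr 1
  ext y
  congr 2
  abel

/-- Neither factor need be continuous. Approximating W in L¹ by continuous compactly supported
weights makes the correlation a uniform limit of continuous functions. -/
lemma continuous_corr {k W : E n → ℝ} {M : ℝ} (hk : AEStronglyMeasurable k volume)
    (hM : ∀ᵐ x, |k x| ≤ M) (hW : Integrable W volume) : Continuous (corr k W) := by
  have hM0 : 0 ≤ M := by
    obtain ⟨x, hx⟩ := hM.exists
    exact (abs_nonneg _).trans hx
  have hkl : LocallyIntegrable k volume := by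
    rw [locallyIntegrable_iff]
    intro S hS
    have : IsFiniteMeasure (volume.restrict S) := ⟨by simpa using hS.measure_lt_top⟩
    exact Integrable.of_bound hk.restrict M (ae_restrict_of_ae hM)
  refine continuous_of_uniform_approx_of_continuous fun u hu => ?_
  obtain ⟨ε, hε, hεu⟩ := Metric.mem_uniformity_dist.1 hu
  obtain ⟨W', hc, hle, hcont, hint⟩ :=
    -- The bound M may be zero, hence the denominator M + 1.
    hW.exists_hasCompactSupport_integral_sub_le (ε := ε / (M + 1) / 2) (by positivity)
  refine ⟨corr k W', continuous_corr_of_hasCompactSupport hkl hcont hc, fun x => hεu ?_⟩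
  have e : corr k W x - corr k W' x = corr k (fun y => W y - W' y) x := by
    unfold corr
    rw [← integral_sub (integrable_corr hk hM hW x) (integrable_corr hk hM hint x)]
    congr 1
    ext y
    ring
  rw [Real.dist_eq, e]
  refine (abs_corr_le hM (hW.sub hint) x).trans_lt ?_
  calc M * ∫ y, |W y - W' y| ≤ M * (ε / (M + 1) / 2) := mul_le_mul_of_nonneg_left hle hM0
    _ = (M / (M + 1)) * (ε / 2) := by field_simp
    _ ≤ 1 * (ε / 2) := by
        refine mul_le_mul_of_nonneg_right ?_ (by positivity)
        rw [div_le_one (by positivity)]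
        linarith
    _ < ε := by linarith

/-- `f` is a polynomial of total degree at most `d`. -/
def IsPolyFun (d : ℕ) (f : E n → ℝ) : Prop :=
  ∃ p : MvPolynomial (Fin n) ℝ, p.totalDegree ≤ d ∧ ∀ x, f x = MvPolynomial.eval (fun a => x a) p

lemma IsPolyFun.sum {ι : Type*} (t : Finset ι) {d : ℕ} {f : ι → E n → ℝ}
    (h : ∀ i ∈ t, IsPolyFun d (f i)) : IsPolyFun d (fun x => ∑ i ∈ t, f i x) := by
  classical
  choose! p hp hfp using h
  refine ⟨∑ i ∈ t, p i, ?_, fun x => ?_⟩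
  · rw [← MvPolynomial.mem_restrictTotalDegree]
    exact Submodule.sum_mem _ fun i hi => (MvPolynomial.mem_restrictTotalDegree _ _ _).2 (hp i hi)
  · rw [map_sum]
    exact Finset.sum_congr rfl fun i hi => hfp i hi x

lemma IsPolyFun.const_mul {d : ℕ} {f : E n → ℝ} (h : IsPolyFun d f) (c : ℝ) :
    IsPolyFun d (fun x => c * f x) := by
  obtain ⟨p, hp, hf⟩ := h
  refine ⟨MvPolynomial.C c * p, ?_, fun x => by rw [map_mul, MvPolynomial.eval_C, ← hf]⟩
  refine (MvPolynomial.totalDegree_mul _ _).trans ?_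
  rw [MvPolynomial.totalDegree_C, zero_add]
  exact hp

lemma IsPolyFun.mono {d d' : ℕ} {f : E n → ℝ} (h : IsPolyFun d f) (hd : d ≤ d') :
    IsPolyFun d' f := by
  obtain ⟨p, hp, hf⟩ := h
  exact ⟨p, hp.trans hd, hf⟩

/-- Split one factor as x + (y - x₀): the first part raises the degree by one, the second is
absorbed into the weight. The induction therefore varies W and assumes integrability against all
continuous functions, which the new weight inherits. -/
lemma isPolyFun_corr_prod (x₀ : E n) (k : ℕ) : ∀ (s : Fin k → Fin n) (W : E n → ℝ),
    (∀ h : E n → ℝ, Continuous h → Integrable (fun y => h y * W y) volume) →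
      IsPolyFun k (corr (fun z => ∏ l, (z (s l) - x₀ (s l))) W) := by
  induction k with
  | zero =>
    intro s W _
    refine ⟨MvPolynomial.C (∫ y, W y), by simp, fun x => ?_⟩
    simp [corr]
  | succ k ih =>
    intro s W hW
    obtain ⟨p, hp, hfp⟩ := ih (fun l => s l.succ) W hW
    obtain ⟨p', hp', hfp'⟩ := ih (fun l => s l.succ) (fun y => (y (s 0) - x₀ (s 0)) * W y)
      (fun h hh => by
        have := hW (fun y => h y * (y (s 0) - x₀ (s 0))) (by fun_prop)
        simpa only [mul_assoc] using this)
    refine ⟨MvPolynomial.X (s 0) * p + p', ?_, fun x => ?_⟩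
    · refine (MvPolynomial.totalDegree_add _ _).trans (max_le ?_ (hp'.trans (Nat.le_succ k)))
      refine (MvPolynomial.totalDegree_mul _ _).trans ?_
      rw [MvPolynomial.totalDegree_X]
      omega
    · rw [map_add, map_mul, MvPolynomial.eval_X, ← hfp, ← hfp']
      unfold corr
      rw [← integral_const_mul, ← integral_add]
      · congr 1
        ext y
        simp only [Fin.prod_univ_succ, PiLp.add_apply]
        ring
      · refine (hW (fun y => ∏ l : Fin k, ((x + y) (s l.succ) - x₀ (s l.succ)))
          ?_).const_mul (x (s 0))
        simp only [PiLp.add_apply]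
        fun_prop
      · have := hW (fun y => (∏ l : Fin k, ((x + y) (s l.succ) - x₀ (s l.succ))) *
          (y (s 0) - x₀ (s 0))) (by simp only [PiLp.add_apply]; fun_prop)
        simpa only [mul_assoc] using this

lemma corr_sum {ι : Type*} (t : Finset ι) (f : ι → E n → ℝ) (a : ι → ℝ) {W : E n → ℝ}
    (hf : ∀ i, Continuous (f i))
    (hW : ∀ h : E n → ℝ, Continuous h → Integrable (fun y => h y * W y) volume) (x : E n) :
    corr (fun z => ∑ i ∈ t, a i * f i z) W x = ∑ i ∈ t, a i * corr (f i) W x := by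
  unfold corr
  simp only [Finset.sum_mul]
  rw [integral_finsetSum]
  · refine Finset.sum_congr rfl fun i _ => ?_
    rw [← integral_const_mul]
    congr 1
    ext y
    ring
  · intro i _
    exact hW (fun y => a i * f i (x + y))
      (continuous_const.mul ((hf i).comp (continuous_const.add continuous_id)))

/-! ### The weights of the stencil functions -/

/-- The product of partial derivatives of the two hat functions of a stencil. -/
def weight (m : ℕ) (T : Macro n) (δ : E n) (a b : Fin n) (y : E n) : ℝ :=
  gradient (hat m T) (y - δ) a * gradient (hat m T) y b

lemma weight_eq_zero {m : ℕ} {T : Macro n} {δ y : E n} (a b : Fin n)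
    (hy : y ∉ overlap (hat m T) δ) : weight m T δ a b y = 0 := by
  rw [mem_overlap_hat, not_and_or, not_not, not_not] at hy
  unfold weight
  rcases hy with hy | hy <;> rw [gradient_hat_eq_zero hy] <;> simp

lemma measurable_gradient (f : E n → ℝ) : Measurable (gradient f) := by
  have : gradient f = fun x => (InnerProductSpace.toDual ℝ (E n)).symm (fderiv ℝ f x) := rfl
  rw [this]
  exact (LinearIsometryEquiv.continuous _).measurable.comp (measurable_fderiv ℝ f)

lemma measurable_weight (m : ℕ) (T : Macro n) (δ : E n) (a b : Fin n) :
    Measurable (weight m T δ a b) := by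
  have h : ∀ a, Measurable fun y => gradient (hat m T) y a := fun a =>
    ((PiLp.continuous_apply 2 (fun _ : Fin n => ℝ) a).measurable).comp (measurable_gradient _)
  exact ((h a).comp (measurable_id.sub_const δ)).mul (h b)

lemma abs_hat_sub_le {m : ℕ} {T : Macro n} (v w : E n) :
    |hat m T v - hat m T w| ≤ 2 ^ m * osc T (v - w) := by
  have h1 : osc T v ≤ osc T w + osc T (v - w) := by
    simpa using osc_add_le T w (v - w)
  have h2 : osc T w ≤ osc T v + osc T (v - w) := by
    have := osc_add_le T v (w - v)
    rwa [← neg_sub v w, osc_neg, ← sub_eq_add_neg, sub_sub_cancel] at this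
  have h3 : |(1 - 2 ^ m * osc T v) - (1 - 2 ^ m * osc T w)| ≤ 2 ^ m * osc T (v - w) := by
    have e : (1 - 2 ^ m * osc T v) - (1 - 2 ^ m * osc T w) = 2 ^ m * (osc T w - osc T v) := by ring
    rw [e, abs_mul, abs_of_pos (by positivity : (0 : ℝ) < 2 ^ m)]
    refine mul_le_mul_of_nonneg_left (abs_le.2 ⟨?_, ?_⟩) (by positivity) <;> linarith
  refine le_trans ?_ h3
  exact abs_max_sub_max_le_max 0 _ 0 _ |>.trans (by simp)

/-- The bound comes from the Lipschitz constant of the hat, so it holds at the kinks too. -/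
lemma norm_gradient_hat_le {m : ℕ} {T : Macro n} {z : E n} {ρ : ℝ} (hρ : 0 < ρ)
    (h : Metric.closedBall z ρ ⊆ T.closedInterior) (y : E n) :
    ‖gradient (hat m T) y‖ ≤ 2 ^ m * (2 * (n + 1) / ρ) := by
  have hl : LipschitzWith (Real.toNNReal (2 ^ m * (2 * (n + 1) / ρ))) (hat m T) := by
    refine LipschitzWith.of_dist_le_mul fun v w => ?_
    rw [Real.coe_toNNReal _ (by positivity), Real.dist_eq, dist_eq_norm, mul_assoc]
    refine (abs_hat_sub_le v w).trans (mul_le_mul_of_nonneg_left ?_ (by positivity))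
    refine (osc_le_of_abs_dlam_le (abs_dlam_le_of_closedBall hρ h · (v - w))).trans_eq ?_
    ring
  rw [gradient, LinearIsometryEquiv.norm_map]
  refine (norm_fderiv_le_of_lipschitz ℝ hl).trans_eq ?_
  rw [Real.coe_toNNReal _ (by positivity)]

lemma overlap_subset_ball (m : ℕ) (T : Macro n) (δ : E n) (hT : 0 < elemDiam T) :
    overlap (hat m T) δ ⊆ Metric.ball 0 ((n + 1) * (elemDiam T / 2 ^ m)) := by
  intro y hy
  have h1 := hat_ne_zero_iff.1 (mem_overlap_hat.1 hy).1
  have h2 : osc T y < 1 / 2 ^ m := by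
    rw [lt_div_iff₀ (by positivity)]; linarith
  rw [mem_ball_zero_iff]
  calc ‖y‖ ≤ (n + 1) * elemDiam T * osc T y := norm_le_osc T y
    _ < (n + 1) * elemDiam T * (1 / 2 ^ m) := mul_lt_mul_of_pos_left h2 (by positivity)
    _ = _ := by ring

lemma abs_weight_le {m : ℕ} {T : Macro n} {z : E n} {ρ : ℝ} (hρ : 0 < ρ)
    (h : Metric.closedBall z ρ ⊆ T.closedInterior) (δ : E n) (a b : Fin n) (y : E n) :
    |weight m T δ a b y| ≤ (2 ^ m * (2 * (n + 1) / ρ)) ^ 2 := by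
  rw [weight, abs_mul, sq]
  exact mul_le_mul ((PiLp.norm_apply_le _ a).trans (norm_gradient_hat_le hρ h _))
    ((PiLp.norm_apply_le _ b).trans (norm_gradient_hat_le hρ h _)) (abs_nonneg _) (by positivity)

lemma abs_weight_le_indicator {m : ℕ} {T : Macro n} {z : E n} {ρ : ℝ} (hT : 0 < elemDiam T)
    (hρ : 0 < ρ) (h : Metric.closedBall z ρ ⊆ T.closedInterior) (δ : E n) (a b : Fin n) (y : E n) :
    |weight m T δ a b y| ≤ (Metric.ball (0 : E n) ((n + 1) * (elemDiam T / 2 ^ m))).indicator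
      (fun _ => (2 ^ m * (2 * (n + 1) / ρ)) ^ 2) y := by
  by_cases hy : y ∈ Metric.ball (0 : E n) ((n + 1) * (elemDiam T / 2 ^ m))
  · rw [indicator_of_mem hy]
    exact abs_weight_le hρ h δ a b y
  · rw [indicator_of_notMem hy, weight_eq_zero a b fun h' => hy (overlap_subset_ball m T δ hT h'),
      abs_zero]

lemma integrable_weight {m : ℕ} {T : Macro n} {z : E n} {ρ : ℝ} (hT : 0 < elemDiam T)
    (hρ : 0 < ρ) (h : Metric.closedBall z ρ ⊆ T.closedInterior) (δ : E n) (a b : Fin n) :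
    Integrable (weight m T δ a b) volume := by
  refine Integrable.mono' (g := (Metric.ball (0 : E n) ((n + 1) * (elemDiam T / 2 ^ m))).indicator
      (fun _ => (2 ^ m * (2 * (n + 1) / ρ)) ^ 2)) ?_
    (measurable_weight m T δ a b).aestronglyMeasurable
    (Filter.Eventually.of_forall (abs_weight_le_indicator hT hρ h δ a b))
  rw [integrable_indicator_iff measurableSet_ball]
  exact integrableOn_const measure_ball_lt_top.ne

/-- Volume of a ball containing the support times the square of the gradient bound; with ρ
comparable to H_T this is of order h_T^(n-2). -/
lemma integral_abs_weight_le {m : ℕ} {T : Macro n} {z : E n} {ρ : ℝ} (hT : 0 < elemDiam T)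
    (hρ : 0 < ρ) (h : Metric.closedBall z ρ ⊆ T.closedInterior) (δ : E n) (a b : Fin n) :
    ∫ y, |weight m T δ a b y| ≤ ((n + 1) * (elemDiam T / 2 ^ m)) ^ n *
      volume.real (Metric.ball (0 : E n) 1) * (2 ^ m * (2 * (n + 1) / ρ)) ^ 2 := by
  have hi : Integrable ((Metric.ball (0 : E n) ((n + 1) * (elemDiam T / 2 ^ m))).indicator
      (fun _ => (2 ^ m * (2 * (n + 1) / ρ)) ^ 2)) volume := by
    rw [integrable_indicator_iff measurableSet_ball]
    exact integrableOn_const measure_ball_lt_top.ne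
  refine (integral_mono (integrable_weight hT hρ h δ a b).abs hi
    (abs_weight_le_indicator hT hρ h δ a b)).trans_eq ?_
  rw [integral_indicator measurableSet_ball, setIntegral_const, smul_eq_mul]
  congr 1
  rw [measureReal_def, measureReal_def, Measure.addHaar_ball_of_pos _ _ (by positivity)]
  rw [ENNReal.toReal_mul, ENNReal.toReal_ofReal (by positivity), finrank_euclideanSpace_fin]

lemma integrable_mul_weight {m : ℕ} {T : Macro n} {z : E n} {ρ : ℝ} (hT : 0 < elemDiam T)
    (hρ : 0 < ρ) (h : Metric.closedBall z ρ ⊆ T.closedInterior) (δ : E n) (a b : Fin n)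
    (f : E n → ℝ) (hf : Continuous f) :
    Integrable (fun y => f y * weight m T δ a b y) volume := by
  have hc := isCompact_closedBall (0 : E n) ((n + 1) * (elemDiam T / 2 ^ m))
  rw [← integrableOn_iff_integrable_of_support_subset
    (s := Metric.closedBall (0 : E n) ((n + 1) * (elemDiam T / 2 ^ m)))]
  · exact (integrable_weight hT hρ h δ a b).integrableOn.continuousOn_mul hf.continuousOn hc
  · intro y hy
    by_contra hy'
    refine hy ?_
    dsimp only
    rw [weight_eq_zero a b fun h' =>
      hy' (Metric.ball_subset_closedBall (overlap_subset_ball m T δ hT h')), mul_zero]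

/-! ### The projection error of a stencil function -/

lemma sobolevSeminorm_le_tensorSeminorm (k : ℕ) (U : Set (E n))
    (K : E n → Matrix (Fin n) (Fin n) ℝ) (a b : Fin n) :
    sobolevSeminorm k U (fun x => K x a b) ≤ tensorSeminorm k U K :=
  (le_ciSup (f := fun b => sobolevSeminorm k U (fun x => K x a b))
    (finite_range _).bddAbove b).trans
    (le_ciSup (f := fun a => ⨆ b, sobolevSeminorm k U (fun x => K x a b))
      (finite_range _).bddAbove a)

lemma tensorSeminorm_nonneg (k : ℕ) (U : Set (E n)) (K : E n → Matrix (Fin n) (Fin n) ℝ) :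
    0 ≤ tensorSeminorm k U K :=
  Real.iSup_nonneg fun _ => Real.iSup_nonneg fun _ => sobolevSeminorm_nonneg _ _ _

lemma exists_bound_indicator {U : Set (E n)} (hU : MeasurableSet U) {v : E n → ℝ}
    (hv : MemLp v ⊤ (volume.restrict U)) :
    AEStronglyMeasurable (U.indicator v) volume ∧ ∃ M : ℝ, ∀ᵐ x, |U.indicator v x| ≤ M := by
  refine ⟨(aestronglyMeasurable_indicator_iff hU).2 hv.1,
    (eLpNormEssSup v (volume.restrict U)).toReal, ?_⟩
  have h1 := ae_le_eLpNormEssSup (f := v) (μ := volume.restrict U)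
  rw [ae_restrict_iff' hU] at h1
  have hfin : eLpNormEssSup v (volume.restrict U) ≠ ⊤ := by
    have := hv.2.ne
    rwa [eLpNorm_exponent_top] at this
  filter_upwards [h1] with x hx
  by_cases hxU : x ∈ U
  · rw [indicator_of_mem hxU, ← Real.norm_eq_abs, ← toReal_enorm]
    exact ENNReal.toReal_mono hfin (hx hxU)
  · rw [indicator_of_notMem hxU, abs_zero]
    exact ENNReal.toReal_nonneg

section

variable {m : ℕ} {T : Macro n} {z : E n} {ρ : ℝ} {K : E n → Matrix (Fin n) (Fin n) ℝ}

/-- On the stencil domain x + y stays in T for y in the overlap, and the weights vanish elsewhere.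
So K may be cut off at T, which leaves globally bounded functions to correlate. -/
lemma stencilFn_eq_corr (hn : n ≠ 0) (hρ : 0 < ρ)
    (hball : Metric.closedBall z ρ ⊆ T.closedInterior)
    (hK : ∀ a b, MemLp (fun x => K x a b) ⊤ (volume.restrict T.interior)) (δ : E n) {x : E n}
    (hx : x ∈ stencilDomain T (hat m T) δ) :
    stencilFn K (hat m T) δ x =
      ∑ a, ∑ b, corr (T.interior.indicator fun y => K y a b) (weight m T δ a b) x := by
  have hi : ∀ a b, Integrable (fun y => T.interior.indicator (fun y => K y a b) (x + y) *
      weight m T δ a b y) volume := fun a b => by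
    obtain ⟨h1, M, hM⟩ := exists_bound_indicator (isOpen_interior hn T).measurableSet (hK a b)
    exact integrable_corr h1 hM (integrable_weight (elemDiam_pos hn T) hρ hball δ a b) x
  unfold corr
  simp_rw [← integral_finsetSum Finset.univ fun b _ => hi _ b]
  rw [← integral_finsetSum Finset.univ fun a _ => integrable_finsetSum _ fun b _ => hi a b,
    ← setIntegral_eq_integral_of_forall_compl_eq_zero (s := overlap (hat m T) δ), stencilFn_hat]
  · refine setIntegral_congr_fun (isOpen_overlap_hat m T δ).measurableSet fun y hy => ?_
    refine Finset.sum_congr rfl fun a _ => Finset.sum_congr rfl fun b _ => ?_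
    rw [indicator_of_mem (add_mem_interior_of_mem_stencilDomain hn hx hy), weight]
    ring
  · intro y hy
    exact Finset.sum_eq_zero fun a _ => Finset.sum_eq_zero fun b _ => by
      rw [weight_eq_zero a b hy, mul_zero]

/-- Without continuity `project` would return its default value 0. -/
lemma continuousOn_stencilFn (hn : n ≠ 0) (hρ : 0 < ρ)
    (hball : Metric.closedBall z ρ ⊆ T.closedInterior)
    (hK : ∀ a b, MemLp (fun x => K x a b) ⊤ (volume.restrict T.interior)) (δ : E n) :
    ContinuousOn (stencilFn K (hat m T) δ) (stencilDomain T (hat m T) δ) := by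
  refine ContinuousOn.congr ?_ fun x hx => stencilFn_eq_corr hn hρ hball hK δ hx
  refine Continuous.continuousOn (continuous_finsetSum _ fun a _ =>
    continuous_finsetSum _ fun b _ => ?_)
  obtain ⟨h1, M, hM⟩ := exists_bound_indicator (isOpen_interior hn T).measurableSet (hK a b)
  exact continuous_corr h1 hM (integrable_weight (elemDiam_pos hn T) hρ hball δ a b)

/-- The bound for the distance of a stencil function from the polynomials. -/
def stencilBound (m r : ℕ) (T : Macro n) (ρ : ℝ) (K : E n → Matrix (Fin n) (Fin n) ℝ) : ℝ :=
  n * (n * (n ^ (r + 1) * elemDiam T ^ (r + 1) * tensorSeminorm (r + 1) T.interior K *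
    (((n + 1) * (elemDiam T / 2 ^ m)) ^ n * volume.real (Metric.ball (0 : E n) 1) *
      (2 ^ m * (2 * (n + 1) / ρ)) ^ 2)))

/-- Q is the stencil function of the polynomial approximation of K, so the difference is a
correlation with K - p, small in L^∞, against weights bounded in L¹. -/
lemma exists_polynomial_approx_stencilFn (hn : n ≠ 0) (hρ : 0 < ρ)
    (hball : Metric.closedBall z ρ ⊆ T.closedInterior) {r : ℕ}
    (hK : ∀ a b, MemSobolev (r + 1) T.interior (fun x => K x a b)) (δ : E n) :
    ∃ Q : E n → ℝ, IsPolyFun r Q ∧ ∀ x ∈ stencilDomain T (hat m T) δ,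
      |stencilFn K (hat m T) δ x - Q x| ≤ stencilBound m r T ρ K := by
  have hT := elemDiam_pos hn T
  have hTo := isOpen_interior hn T
  have hdiam : Metric.diam T.interior ≤ elemDiam T :=
    Metric.diam_mono T.interior_subset_closedInterior (isBounded_closedInterior T)
  choose x₀ c hc using fun a b => (hK a b).exists_polynomial_approx hTo (convex_interior hn T)
    (interior_nonempty hn T) ((isBounded_closedInterior T).subset T.interior_subset_closedInterior)
  set κ : ℝ := n ^ (r + 1) * elemDiam T ^ (r + 1) * tensorSeminorm (r + 1) T.interior K with hκ
  have hκ0 : 0 ≤ κ := by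
    have := tensorSeminorm_nonneg (r + 1) T.interior K
    positivity
  set p : Fin n → Fin n → E n → ℝ := fun a b x => ∑ k ∈ Finset.range (r + 1),
    ∑ s : Fin k → Fin n, c a b k s * ∏ l, (x (s l) - x₀ a b (s l)) with hp
  have hW := fun a b => integrable_mul_weight (m := m) hT hρ hball δ a b
  have hpc : ∀ a b, Continuous (p a b) := fun a b => by
    simp only [hp]; fun_prop
  have happ : ∀ a b, ∀ᵐ x, |T.interior.indicator (fun x => K x a b - p a b x) x| ≤ κ := by
    intro a b
    have := hc a b
    rw [ae_restrict_iff' hTo.measurableSet] at this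
    filter_upwards [this] with x hx
    by_cases hxT : x ∈ T.interior
    · rw [indicator_of_mem hxT]
      refine (hx hxT).trans ?_
      refine mul_le_mul ?_ (sobolevSeminorm_le_tensorSeminorm _ _ K a b)
        (sobolevSeminorm_nonneg _ _ _) (by positivity)
      exact mul_le_mul_of_nonneg_left (pow_le_pow_left₀ Metric.diam_nonneg hdiam _)
        (by positivity)
    · rw [indicator_of_notMem hxT, abs_zero]; exact hκ0
  refine ⟨fun x => ∑ a, ∑ b, corr (p a b) (weight m T δ a b) x, ?_, ?_⟩
  · refine IsPolyFun.sum _ fun a _ => IsPolyFun.sum _ fun b _ => ?_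
    have e : corr (p a b) (weight m T δ a b) = fun x => ∑ k ∈ Finset.range (r + 1),
        ∑ s : Fin k → Fin n, c a b k s *
          corr (fun x => ∏ l, (x (s l) - x₀ a b (s l))) (weight m T δ a b) x := by
      ext x
      have h1 := corr_sum (Finset.range (r + 1)) (fun k x => ∑ s : Fin k → Fin n,
        c a b k s * ∏ l, (x (s l) - x₀ a b (s l))) (fun _ => 1) (fun k => by fun_prop)
        (hW a b) x
      simp only [one_mul] at h1
      rw [h1]
      refine Finset.sum_congr rfl fun k _ => ?_
      exact corr_sum Finset.univ (fun (s : Fin k → Fin n) x => ∏ l, (x (s l) - x₀ a b (s l)))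
        (c a b k) (fun s => by fun_prop) (hW a b) x
    rw [e]
    refine IsPolyFun.sum _ fun k hk => IsPolyFun.sum _ fun s _ => IsPolyFun.const_mul ?_ _
    exact (isPolyFun_corr_prod _ k s _ (hW a b)).mono
      (Nat.lt_succ_iff.1 (Finset.mem_range.1 hk))
  · intro x hx
    rw [stencilFn_eq_corr hn hρ hball (fun a b => (hK a b).1) δ hx, ← Finset.sum_sub_distrib]
    have key : ∀ a b, |corr (T.interior.indicator fun y => K y a b) (weight m T δ a b) x -
        corr (p a b) (weight m T δ a b) x| ≤ κ * (((n + 1) * (elemDiam T / 2 ^ m)) ^ n *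
          volume.real (Metric.ball (0 : E n) 1) * (2 ^ m * (2 * (n + 1) / ρ)) ^ 2) := by
      intro a b
      have hw := integrable_weight (m := m) hT hρ hball δ a b
      obtain ⟨h1, M, hM⟩ := exists_bound_indicator hTo.measurableSet (hK a b).1
      have e : corr (T.interior.indicator fun y => K y a b) (weight m T δ a b) x -
          corr (p a b) (weight m T δ a b) x =
          corr (T.interior.indicator fun y => K y a b - p a b y) (weight m T δ a b) x := by
        unfold corr
        rw [← integral_sub (integrable_corr h1 hM hw x)
          (hW a b (fun y => p a b (x + y)) ((hpc a b).comp (continuous_const.add continuous_id)))]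
        congr 1
        ext y
        -- Only K is cut off at T, the polynomial is not; the discrepancy occurs where the weight is
        -- zero.
        by_cases hy : y ∈ overlap (hat m T) δ
        · have := add_mem_interior_of_mem_stencilDomain hn hx hy
          rw [indicator_of_mem this, indicator_of_mem this]
          ring
        · simp [weight_eq_zero a b hy]
      rw [e]
      exact (abs_corr_le (happ a b) hw x).trans
        (mul_le_mul_of_nonneg_left (integral_abs_weight_le hT hρ hball δ a b) hκ0)
    calc _ ≤ ∑ a, |∑ b, corr (T.interior.indicator fun y => K y a b) (weight m T δ a b) x -
            ∑ b, corr (p a b) (weight m T δ a b) x| := Finset.abs_sum_le_sum_abs _ _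
      _ ≤ ∑ _a : Fin n, ∑ _b : Fin n, κ * (((n + 1) * (elemDiam T / 2 ^ m)) ^ n *
          volume.real (Metric.ball (0 : E n) 1) * (2 ^ m * (2 * (n + 1) / ρ)) ^ 2) := by
          refine Finset.sum_le_sum fun a _ => ?_
          rw [← Finset.sum_sub_distrib]
          exact (Finset.abs_sum_le_sum_abs _ _).trans (Finset.sum_le_sum fun b _ => key a b)
      _ = stencilBound m r T ρ K := by
          simp only [Finset.sum_const, Finset.card_univ, Fintype.card_fin, nsmul_eq_mul]
          rfl

/-- The projection fixes Q, so f - Pf = (f - Q) - P(f - Q). The absolute value of Λ appears because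
its sign is not prescribed. -/
lemma abs_sub_project_le {S : Set (E n)} {q : ℕ} {Λ : ℝ} {P : C(S, ℝ) →ₗ[ℝ] C(S, ℝ)}
    (hP : IsPolyProjection q Λ P) {f Q : E n → ℝ} (hf : ContinuousOn f S) (hQ : IsPolyFun q Q)
    {B : ℝ} (hB : ∀ x ∈ S, |f x - Q x| ≤ B) {x : E n} (hx : x ∈ S) :
    |f x - project P f x| ≤ (1 + |Λ|) * B := by
  have hB0 : 0 ≤ B := (abs_nonneg _).trans (hB x hx)
  obtain ⟨p, hp, hQp⟩ := hQ
  have hQc : Continuous Q := by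
    have : Continuous fun x : E n => MvPolynomial.eval (fun a => x a) p :=
      (MvPolynomial.continuous_eval p).comp (by fun_prop)
    exact this.congr fun x => (hQp x).symm
  set F : C(S, ℝ) := ⟨S.domRestrict f, hf.domRestrict⟩ with hF
  set G : C(S, ℝ) := ⟨fun x => Q x, hQc.comp continuous_subtype_val⟩ with hG
  have hPG : P G = G := hP.fix G ⟨p, hp, fun y => hQp y⟩
  have h1 := hP.bound (F - G) B (fun y => hB y y.2) ⟨x, hx⟩
  rw [map_sub, hPG] at h1
  have e : project P f x = P F ⟨x, hx⟩ := by
    rw [project, dif_pos hf, dif_pos hx]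
  rw [e]
  have h2 : |P F ⟨x, hx⟩ - Q x| ≤ Λ * B := h1
  have h3 : Λ * B ≤ |Λ| * B := mul_le_mul_of_nonneg_right (le_abs_self _) hB0
  have h4 := hB x hx
  rw [abs_le] at h2 h4 ⊢
  constructor <;> linarith [h2.1, h2.2, h4.1, h4.2]

/-- The type of P depends on the test function, so its identification with `hat` enters as an
equation to be substituted. -/
lemma abs_stencilFn_sub_project_le (hn : n ≠ 0) (hρ : 0 < ρ)
    (hball : Metric.closedBall z ρ ⊆ T.closedInterior) {r q : ℕ} {Λ : ℝ} (hr : r ≤ q)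
    (hK : ∀ a b, MemSobolev (r + 1) T.interior (fun x => K x a b)) {δ : E n} {φ : E n → ℝ}
    (hφ : φ = hat m T) {P : C(stencilDomain T φ δ, ℝ) →ₗ[ℝ] C(stencilDomain T φ δ, ℝ)}
    (hP : IsPolyProjection q Λ P) {x : E n} (hx : x ∈ stencilDomain T φ δ) :
    |stencilFn K φ δ x - project P (stencilFn K φ δ) x| ≤
      (1 + |Λ|) * stencilBound m r T ρ K := by
  subst hφ
  obtain ⟨Q, hQ, hB⟩ := exists_polynomial_approx_stencilFn (m := m) hn hρ hball hK δ
  exact abs_sub_project_le hP (continuousOn_stencilFn hn hρ hball (fun a b => (hK a b).1) δ)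
    (hQ.mono hr) hB hx

end

/-! ### The constant and the entrywise error bound -/

/-- The constant of the error estimate. -/
def errorConst (n q : ℕ) (σ Λ : ℝ) : ℝ :=
  -- The exponent q + 1 in place of r + 1 makes the constant independent of r; the final summand 1
  -- keeps it positive when σ = 0.
  (1 + |Λ|) * (n * (n * (n ^ (q + 1) * ((n + 1) ^ n * volume.real (Metric.ball (0 : E n) 1) *
    (2 * (n + 1) * σ) ^ 2)))) + 1

lemma errorConst_pos (n q : ℕ) (σ Λ : ℝ) : 0 < errorConst n q σ Λ := by
  unfold errorConst
  positivity

/-- Shape regularity replaces 1/ρ by σ/H_T, and the powers combine to h_T^n · h_T^(-2) = h_T^(n-2);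
the natural subtraction is exact as n ≥ 2. -/
lemma stencilBound_le (hn : n = 2 ∨ n = 3) {m r q : ℕ} (hr : r ≤ q) {T : Macro n} {ρ σ Λ : ℝ}
    (hρ : 0 < ρ) (hσ : elemDiam T ≤ σ * ρ) (K : E n → Matrix (Fin n) (Fin n) ℝ) :
    (1 + |Λ|) * stencilBound m r T ρ K ≤ errorConst n q σ Λ * (elemDiam T / 2 ^ m) ^ (n - 2) *
      elemDiam T ^ (r + 1) * tensorSeminorm (r + 1) T.interior K := by
  have hT := elemDiam_pos (by omega : n ≠ 0) T
  have hS := tensorSeminorm_nonneg (r + 1) T.interior K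
  set H := elemDiam T
  set S := tensorSeminorm (r + 1) T.interior K
  set V := volume.real (Metric.ball (0 : E n) 1)
  have hV : 0 ≤ V := measureReal_nonneg
  have h1 : (2 ^ m * (2 * (n + 1) / ρ)) ^ 2 ≤ (2 * (n + 1) * σ) ^ 2 * (2 ^ m / H) ^ 2 := by
    rw [← mul_pow]
    refine pow_le_pow_left₀ (by positivity) ?_ 2
    have : 1 / ρ ≤ σ / H := by
      rw [div_le_div_iff₀ hρ hT]; linarith
    calc 2 ^ m * (2 * ((n : ℝ) + 1) / ρ) = 2 ^ m * (2 * (n + 1)) * (1 / ρ) := by ring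
      _ ≤ 2 ^ m * (2 * (n + 1)) * (σ / H) := mul_le_mul_of_nonneg_left this (by positivity)
      _ = _ := by ring
  have h2 : (n : ℝ) ^ (r + 1) ≤ n ^ (q + 1) := by
    have : (1 : ℝ) ≤ n := by
      have : 1 ≤ n := by omega
      exact_mod_cast this
    exact pow_le_pow_right₀ this (by omega)
  have h3 : (H / 2 ^ m) ^ n * (2 ^ m / H) ^ 2 = (H / 2 ^ m) ^ (n - 2) := by
    have : n = n - 2 + 2 := by omega
    conv_lhs => rw [this]
    rw [pow_add, mul_assoc, ← mul_pow]
    have : H / 2 ^ m * (2 ^ m / H) = 1 := by field_simp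
    rw [this, one_pow, mul_one]
  have h4 : stencilBound m r T ρ K ≤ n * (n * (n ^ (q + 1) * H ^ (r + 1) * S *
      (((n + 1) * (H / 2 ^ m)) ^ n * V * ((2 * (n + 1) * σ) ^ 2 * (2 ^ m / H) ^ 2)))) := by
    unfold stencilBound
    gcongr
  calc (1 + |Λ|) * stencilBound m r T ρ K ≤ (1 + |Λ|) * (n * (n * (n ^ (q + 1) * H ^ (r + 1) * S *
      (((n + 1) * (H / 2 ^ m)) ^ n * V * ((2 * (n + 1) * σ) ^ 2 * (2 ^ m / H) ^ 2))))) :=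
        mul_le_mul_of_nonneg_left h4 (by positivity)
    _ = (errorConst n q σ Λ - 1) * ((H / 2 ^ m) ^ n * (2 ^ m / H) ^ 2) * H ^ (r + 1) * S := by
        unfold errorConst
        rw [mul_pow]
        ring
    _ ≤ errorConst n q σ Λ * ((H / 2 ^ m) ^ n * (2 ^ m / H) ^ 2) * H ^ (r + 1) * S := by
        gcongr
        linarith
    _ = _ := by rw [h3]

/-- An entry of the error matrix is bounded by the local quantities of a macro-element that
contains both vertices, one of them in its interior, if it does not vanish. -/
lemma abs_error_entry_le (hn : n = 2 ∨ n = 3) {q m r : ℕ} {σ Λ : ℝ} {Ω : Set (E n)}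
    {Th : Set (Macro n)} {c : Macro n → E n} {P : ProjectionFamily Th m c}
    (K : E n → Matrix (Fin n) (Fin n) ℝ) (h : IsMacroMesh Ω Th) (hσ : ShapeRegular σ Th)
    (hc : ∀ T ∈ Th, (latticeInterior m T).Nonempty → c T ∈ latticeInterior m T)
    (hP : ∀ T ∈ Th, ∀ δ ∈ translations Th m T, IsPolyProjection q Λ (P T δ)) (hr : r ≤ q)
    (i j : vertices Th m) :
    (trueMatrix Ω Th m K - surrogateMatrix Ω Th m K c P) i j = 0 ∨
      ∃ T ∈ Th, (i.1 ∈ latticeInterior m T ∨ j.1 ∈ latticeInterior m T) ∧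
        ((∀ a b, MemSobolev (r + 1) T.interior (fun x => K x a b)) →
          |(trueMatrix Ω Th m K - surrogateMatrix Ω Th m K c P) i j| ≤
            errorConst n q σ Λ * (elemDiam T / 2 ^ m) ^ (n - 2) * elemDiam T ^ (r + 1) *
              tensorSeminorm (r + 1) T.interior K) := by
  have hn0 : n ≠ 0 := by omega
  rcases trueMatrix_sub_surrogateMatrix hn h K c P i j with h0 | ⟨T, hT, hij, hi, hj, hδ, e⟩
  · exact Or.inl h0
  refine Or.inr ⟨T, hT, hij, fun hK => ?_⟩
  obtain ⟨z, ρ, hρ, hball, hHρ⟩ := hσ T hT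
  have hcT : c T ∈ latticeInterior m T := by
    refine hc T hT ?_
    rcases hij with hi | hj
    · exact ⟨_, hi⟩
    · exact ⟨_, hj⟩
  have hφ := testFn_eq_hat hn h hT hcT
  rw [e]
  refine le_trans ?_ (stencilBound_le hn hr hρ hHρ K)
  rw [← hφ]
  refine abs_stencilFn_sub_project_le hn0 hρ hball hr hK hφ (hP T hT _ hδ) ?_
  rw [hφ]
  exact mem_stencilDomain hn (by rwa [add_sub_cancel]) hi hcT

end SurrogateFEM

end

theorem mainTheorem3 (n : ℕ) (hn : n = 2 ∨ n = 3) (q : ℕ) (σ Λ : ℝ) :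
    ∃ C : ℝ, 0 < C ∧
      ∀ (Ω : Set (SurrogateFEM.E n)) (Th : Set (SurrogateFEM.Macro n)) (m : ℕ)
        (c : SurrogateFEM.Macro n → SurrogateFEM.E n)
        (P : SurrogateFEM.ProjectionFamily Th m c)
        (K : SurrogateFEM.E n → Matrix (Fin n) (Fin n) ℝ) (r : ℕ),
        SurrogateFEM.IsMacroMesh Ω Th →
        SurrogateFEM.ShapeRegular σ Th →
        (∀ T ∈ Th, (SurrogateFEM.latticeInterior m T).Nonempty →
          c T ∈ SurrogateFEM.latticeInterior m T) →
        (∀ T ∈ Th, ∀ δ ∈ SurrogateFEM.translations Th m T,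
          SurrogateFEM.IsPolyProjection q Λ (P T δ)) →
        r ≤ q →
        (∀ T ∈ Th,
          (∀ a b, SurrogateFEM.MemSobolev (r + 1) T.interior (fun x => K x a b)) →
          SurrogateFEM.maxNormOn (SurrogateFEM.lattice m T)
              (SurrogateFEM.trueMatrix Ω Th m K - SurrogateFEM.surrogateMatrix Ω Th m K c P) ≤
            C * (SurrogateFEM.elemDiam T / 2 ^ m) ^ (n - 2) * SurrogateFEM.elemDiam T ^ (r + 1) *
              SurrogateFEM.tensorSeminorm (r + 1) T.interior K) ∧
        ((∀ T ∈ Th, ∀ a b, SurrogateFEM.MemSobolev (r + 1) T.interior (fun x => K x a b)) →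
          SurrogateFEM.maxNorm
              (SurrogateFEM.trueMatrix Ω Th m K - SurrogateFEM.surrogateMatrix Ω Th m K c P) ≤
            C * (SurrogateFEM.meshSize Th / 2 ^ m) ^ (n - 2) *
              SurrogateFEM.meshSize Th ^ (r + 1) *
              ⨆ T : Th, SurrogateFEM.tensorSeminorm (r + 1) T.1.interior K) := by
  have hn0 : n ≠ 0 := by omega
  refine ⟨SurrogateFEM.errorConst n q σ Λ, SurrogateFEM.errorConst_pos n q σ Λ, ?_⟩
  intro Ω Th m c P K r h hσ hc hP hr
  have hentry := SurrogateFEM.abs_error_entry_le hn K h hσ hc hP hr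
  have hC := SurrogateFEM.errorConst_pos n q σ Λ
  constructor
  · intro T hT hK
    have hH := SurrogateFEM.elemDiam_pos hn0 T
    have hS := SurrogateFEM.tensorSeminorm_nonneg (r + 1) T.interior K
    refine Real.sSup_le ?_ (by positivity)
    rintro _ ⟨i, j, hi, hj, rfl⟩
    rcases hentry i j with h0 | ⟨T', hT', hij, hb⟩
    · rw [h0, abs_zero]
      positivity
    -- The error entry lives on an element that has one of the points in its interior. Both points
    -- belong to T, so this element is T, and regularity of K on T alone is enough.
    have hTT : T = T' := by
      rcases hij with hi' | hj'
      · exact h.eq_of_mem_interior hn0 hT' hT hi'.2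
          (SurrogateFEM.lattice_subset_closedInterior m T hi)
      · exact h.eq_of_mem_interior hn0 hT' hT hj'.2
          (SurrogateFEM.lattice_subset_closedInterior m T hj)
    subst hTT
    exact hb hK
  · intro hK
    -- Finiteness bounds the suprema over the mesh; an unbounded real supremum would default to 0.
    have : Finite Th := h.finite
    have hmesh : 0 ≤ SurrogateFEM.meshSize Th := Real.iSup_nonneg fun T => Metric.diam_nonneg
    have hsup : 0 ≤ ⨆ T : Th, SurrogateFEM.tensorSeminorm (r + 1) T.1.interior K :=
      Real.iSup_nonneg fun T => SurrogateFEM.tensorSeminorm_nonneg _ _ _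
    refine Real.sSup_le ?_ (by positivity)
    rintro _ ⟨i, j, -, -, rfl⟩
    rcases hentry i j with h0 | ⟨T, hT, -, hb⟩
    · rw [h0, abs_zero]
      positivity
    have hH := SurrogateFEM.elemDiam_pos hn0 T
    have hS := SurrogateFEM.tensorSeminorm_nonneg (r + 1) T.interior K
    have h1 : SurrogateFEM.elemDiam T ≤ SurrogateFEM.meshSize Th :=
      le_ciSup (f := fun T : Th => SurrogateFEM.elemDiam T.1) (Set.finite_range _).bddAbove ⟨T, hT⟩
    have h2 : SurrogateFEM.tensorSeminorm (r + 1) T.interior K ≤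
        ⨆ T : Th, SurrogateFEM.tensorSeminorm (r + 1) T.1.interior K :=
      le_ciSup (f := fun T : Th => SurrogateFEM.tensorSeminorm (r + 1) T.1.interior K)
        (Set.finite_range _).bddAbove ⟨T, hT⟩
    refine (hb (hK T hT)).trans ?_
    gcongr
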